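/- Let $\operatorname{sign}(y)=1$ for $y\ge 0$ and $\operatorname{sign}(y)=-1$ for $y<0$, and let $F:\mathbb{R}^2\to\mathbb{R}^2$ be the map $$F(x,y)=\begin{pmatrix}\cos\alpha&\sin\alpha\\-\sin\alpha&\cos\alpha\end{pmatrix}\begin{pmatrix}x-\operatorname{sign}(y)\\y\end{pmatrix},\qquad \alpha=\frac{\pi}{3}.$$ The critical set $\mathcal F$ of $F$ is the set of all points $p$ such that $F^i(p)\in\{y=0\}$ for some integer $i\ge 0$. Let $\mathcal{F}_{\pi/3}$ be the trihexagonal grid formed by the straight lines $y=\sqrt3(x-2k-1)$, $y=\sqrt3\,\ell$ and $y=-\sqrt3(x-2m)$ with $k,\ell,m\in\mathbb{Z}$, let $\mathcal{U}_{\pi/3}=\mathbb{R}^2\setminus\mathcal{F}_{\pi/3}$, and call tiles the non-empty sets $$T_{k,\ell,m}=\{(x,y):\ \sqrt3(x-2k-1)<y<\sqrt3(x-2k+1),\ \sqrt3\,\ell<y<\sqrt3(\ell+1),\ -\sqrt3(x-2m)<y<-\sqrt3(x-2m-2)\}.$$ With $B=\left\lfloor \frac{3x-\sqrt3y+3}{6}\right\rfloor$,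 $C=\left\lfloor\frac{\sqrt3 y}{3}\right\rfloor$ and $D=\left\lfloor\frac{3x+\sqrt3y}{6}\right\rfloor$, put $$V_{\pi/3}(x,y)=\max\bigl(|B-C+D|,\ |B+C+D+1|-1,\ |-B+C+D+1|-1\bigr).$$ A necklace of $M$ $n$-gons is a union of $M$ pairwise disjoint tiles, each of them an open regular $n$-gon, which, when they are labelled by $\mathbb{Z}_M=\mathbb{Z}/M\mathbb{Z}$ in clockwise order around the origin (according to the argument of their centers), are such that the closures of any two consecutive ones intersect. Periods are minimal periods, and $\mathbb{N}_0=\{0,1,2,\dots\}$. Then: (i) $\mathcal F=\mathcal{F}_{\pi/3}$. (ii) $V=V_{\pi/3}$ is a first integral of $F$ on $\mathcal{U}_{\pi/3}$, that is, $F$ maps $\mathcal{U}_{\pi/3}$ into itself, $V\circ F=V$ on $\mathcal{U}_{\pi/3}$, and $V$ is not constant on $\mathcal{U}_{\pi/3}$. Moreover: (a) For each even $c\in\mathbb{N}_0$, the level set $\{V=c\}\cap\mathcal{U}_{\pi/3}$ is a necklace of $3c+2$ hexagons, and $F$ maps the hexagon with label $i\in\mathbb{Z}_{3c+2}$ onto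 the hexagon with label $i+c/2$, and the center of the former to the center of the latter. If $c=4j$ (respectively $c=4j+2$) with $j\in\mathbb{N}_0$, each hexagon of this level set is invariant by $F^{3c/2+1}$ (respectively $F^{3c+2}$), and on it this iterate is a rotation of order $6$ (respectively $3$) around its center. All points of these hexagons other than the centers have period $9c+6$. (b) For each odd $c\in\mathbb{N}_0$, the level set $\{V=c\}\cap\mathcal{U}_{\pi/3}$ is a necklace of $6c+4$ triangles, and $F$ maps the triangle with label $i\in\mathbb{Z}_{6c+4}$ onto the triangle with label $i+c$, and the center of the former to the center of the latter. Each triangle of this level set is invariant by $F^{6c+4}$, and on it $F^{6c+4}$ is a rotation of order $3$ around its center. All points of these triangles other than the centers have period $18c+12$. (iii) Every point of $\mathcal F$ is periodic, with period $36n+6$, $18n+9$, $18n+15$ or $108n+72$ for some $n\in\mathbb{N}_0$. (iv) $F$ is pointwise periodic, that is, it is bijective and all its points are periodic, and its set of periods is $$\operatorname{Per}(F)=\{6n+1,\ 12n+8,\ 12n+10,\ 18n+9,\ 18n+15,\ 36n+6,\ 36n+24,\ 36n+30,\ 108n+72\ :\ n\in\mathbb{N}_0\}.$$ -/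

import Mathlib

namespace PiecewiseRotation

noncomputable section

/-- The sign function with the convention `sgn 0 = 1`. -/
def sgn (y : ℝ) : ℝ := if 0 ≤ y then 1 else -1

/-- The planar map `F(x,y) = R (x - sgn y, y)ᵗ`, `R` having rows `(cos α, sin α)` and
`(-sin α, cos α)`. -/
def F (α : ℝ) (p : ℝ × ℝ) : ℝ × ℝ :=
  (Real.cos α * (p.1 - sgn p.2) + Real.sin α * p.2,
    -Real.sin α * (p.1 - sgn p.2) + Real.cos α * p.2)

/-- The critical line, on which `F` is discontinuous. -/
def criticalLine : Set (ℝ × ℝ) := {p | p.2 = 0}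

/-- The critical set: the union of all the preimages of the critical line. -/
def criticalSet (α : ℝ) : Set (ℝ × ℝ) := ⋃ i : ℕ, (F α)^[i] ⁻¹' criticalLine

/-- The trihexagonal grid: the lines `y = √3 (x - 2k - 1)`, `y = √3 ℓ` and `y = -√3 (x - 2m)`
with `k, ℓ, m` integers. -/
def grid : Set (ℝ × ℝ) :=
  {p | (∃ k : ℤ, p.2 = √3 * (p.1 - 2 * k - 1)) ∨ (∃ l : ℤ, p.2 = √3 * l) ∨
    (∃ m : ℤ, p.2 = -√3 * (p.1 - 2 * m))}

/-- The open tile with indices `k, ℓ, m` cut out by the grid. -/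
def tile (k l m : ℤ) : Set (ℝ × ℝ) :=
  {p | (√3 * (p.1 - 2 * k - 1) < p.2 ∧ p.2 < √3 * (p.1 - 2 * k + 1)) ∧
    (√3 * l < p.2 ∧ p.2 < √3 * (l + 1)) ∧
    (-√3 * (p.1 - 2 * m) < p.2 ∧ p.2 < -√3 * (p.1 - 2 * m - 2))}

def B (p : ℝ × ℝ) : ℤ := ⌊(3 * p.1 - √3 * p.2 + 3) / 6⌋

def C (p : ℝ × ℝ) : ℤ := ⌊√3 * p.2 / 3⌋

def D (p : ℝ × ℝ) : ℤ := ⌊(3 * p.1 + √3 * p.2) / 6⌋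

/-- The function `V = max(|B - C + D|, |B + C + D + 1| - 1, |-B + C + D + 1| - 1)`. -/
def V (p : ℝ × ℝ) : ℝ :=
  ((max |B p - C p + D p|
    (max (|B p + C p + D p + 1| - 1) (|-B p + C p + D p + 1| - 1)) : ℤ) : ℝ)

/-- `W` is a first integral of `f` on the invariant set `U`: it is invariant under `f` and
not constant. -/
def IsFirstIntegralOn (f : ℝ × ℝ → ℝ × ℝ) (W : ℝ × ℝ → ℝ) (U : Set (ℝ × ℝ)) : Prop :=
  Set.MapsTo f U U ∧ (∀ p ∈ U, W (f p) = W p) ∧ ∃ p ∈ U, ∃ q ∈ U, W p ≠ W q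

/-- `S` is an open regular polygon with `n` sides and centre `X`: the intersection of the `n`
open half-planes at the same distance `ρ > 0` from `X` whose outer normals point in the
directions `φ + 2πj/n`. -/
def IsOpenRegularPolygon (n : ℕ) (S : Set (ℝ × ℝ)) (X : ℝ × ℝ) : Prop :=
  3 ≤ n ∧ ∃ ρ : ℝ, 0 < ρ ∧ ∃ φ : ℝ, S = {p | ∀ j : ℕ, j < n →
    (p.1 - X.1) * Real.cos (φ + 2 * Real.pi * j / n) +
      (p.2 - X.2) * Real.sin (φ + 2 * Real.pi * j / n) < ρ}

/-- On the set `S`, the map `f` is a rotation of order `n` around the point `X`. -/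
def IsRotationOn (f : ℝ × ℝ → ℝ × ℝ) (S : Set (ℝ × ℝ)) (X : ℝ × ℝ) (n : ℕ) : Prop :=
  ∃ θ : ℝ, addOrderOf (θ : Real.Angle) = n ∧ ∀ p ∈ S,
    f p = (X.1 + (Real.cos θ * (p.1 - X.1) - Real.sin θ * (p.2 - X.2)),
      X.2 + (Real.sin θ * (p.1 - X.1) + Real.cos θ * (p.2 - X.2)))

/-- `S` is a necklace with beads `T i`, `i ∈ ℤ/M`: the beads are pairwise disjoint open regular
`n`-gons with centres `X i`, they are tiles of the grid, their union is `S`, two consecutive beads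
touch each other, and they are numbered in clockwise order around the origin (starting from
the negative horizontal axis). -/
structure IsNecklace (S : Set (ℝ × ℝ)) (n M : ℕ) (T : ZMod M → Set (ℝ × ℝ))
    (X : ZMod M → ℝ × ℝ) : Prop where
  tiles : ∀ i, ∃ k l m : ℤ, T i = tile k l m
  polygon : ∀ i, IsOpenRegularPolygon n (T i) (X i)
  disjoint : ∀ i j, i ≠ j → Disjoint (T i) (T j)
  union : S = ⋃ i, T i
  touch : ∀ i, (closure (T i) ∩ closure (T (i + 1))).Nonempty
  clockwise : ∀ i j : ZMod M, i.val < j.val →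
    Complex.arg ⟨(X j).1, (X j).2⟩ < Complex.arg ⟨(X i).1, (X i).2⟩

/-- The map `f` permutes the beads `T i` of a necklace, together with their centres `X i`,
as the map `i ↦ i + u` of `ℤ/M`. -/
def ActsAsShift (f : ℝ × ℝ → ℝ × ℝ) {M : ℕ} (T : ZMod M → Set (ℝ × ℝ))
    (X : ZMod M → ℝ × ℝ) (u : ℕ) : Prop :=
  ∀ i, f '' T i = T (i + (u : ZMod M)) ∧ f (X i) = X (i + (u : ZMod M))

/-- A pointwise periodic map: a bijection all of whose points are periodic. -/
def PointwisePeriodic (f : ℝ × ℝ → ℝ × ℝ) : Prop :=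
  Function.Bijective f ∧ ∀ p, p ∈ Function.periodicPts f

/-- The set of (minimal) periods of the periodic points of `f`. -/
def Per (f : ℝ × ℝ → ℝ × ℝ) : Set ℕ :=
  {n | ∃ p ∈ Function.periodicPts f, Function.minimalPeriod f p = n}

end

end PiecewiseRotation

namespace PiecewiseRotation

/-! In the sheared coordinates `x = 2b + u - 1`, `y = √3 u` the grid is given by three families:
`b`, `u` and `w = b + u - 1/2` integral. There `F` is piecewise affine with one linear part of order
6, and it permutes the families cyclically. The reflection `p ↦ -p` reads `(b, u) ↦ (1 - b, -u)` and
commutes with `F` off the line `y = 0`.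

On the grid, the point is that the cube of the linear part is `-1`: up to the reflection, which
`flipped` records, the third iterate is one of three unit translations of `(b, u)`, chosen by
whether `b` and `w` exceed 1. A point with integral `u` above the critical line therefore climbs
along one side of a level set, runs along a second, and descends along the third until it hits `u =
0` exactly. Counting steps gives the first return of the third iterate to the critical line
explicitly (`excursion_right`, `excursion_left`). This return map fixes the even integers, exchanges
certain half-unit intervals in pairs (or fixes one) and permutes the other half-unit intervals six
at a time; adding the return times gives the periods. Nothing is missed by cubing, because
`horizontalPts` is revisited only at multiples of three (`three_dvd_of_isPeriodicPt`). A decreasing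
integer potential shows that grid points do reach the critical line, which identifies the critical
set. Ties on the critical line are the delicate point: `sgn 0 = 1` breaks the reflection symmetry,
hence the parity in `Beyond`.

Off the grid, a tile is determined by its triple of floors, and `F` carries it to another tile by a
rotation of `-π/3` about the centres (`F_mem_cellTile_iff`, `F_of_mem_cellTile`). The upper half of
a level set is an explicit three-sided chain of tiles and the lower half is its reflection; in
clockwise labels `F` is a shift (`isCellCycle_hexagons`, `isCellCycle_triangles`). Invariance of `V`
is a consequence. If there are `M` tiles shifted by `u`, the `n`-th iterate returns a tile to itself
iff `M ∣ n * u`, and fixes a point other than the centre iff moreover `6 ∣ n`; the periods are then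
arithmetic. -/

open Function

/-! ### Affine coordinates and the conjugated map -/

/-- Affine coordinates `(b, u)` of the plane adapted to the grid. -/
noncomputable def affineCoord : ℝ × ℝ ≃ ℝ × ℝ where
  toFun p := (2 * p.1 + p.2 - 1, √3 * p.2)
  invFun p := ((p.1 - p.2 / √3 + 1) / 2, p.2 / √3)
  left_inv p := by
    have h : √3 ≠ 0 := by positivity
    ext
    · field_simp; ring
    · field_simp
  right_inv p := by
    have h : √3 ≠ 0 := by positivity
    ext
    · field_simp; ring
    · field_simp

theorem affineCoord_apply (b u : ℝ) : affineCoord (b, u) = (2 * b + u - 1, √3 * u) := rfl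

/-- The map `F (π / 3)` in affine coordinates. -/
noncomputable def affineMap (p : ℝ × ℝ) : ℝ × ℝ :=
  if 0 ≤ p.2 then (p.1 + p.2 - 1 / 2, 1 - p.1) else (p.1 + p.2 + 1 / 2, -p.1)

theorem affineMap_of_nonneg {b u : ℝ} (h : 0 ≤ u) :
    affineMap (b, u) = (b + u - 1 / 2, 1 - b) := if_pos h

theorem affineMap_of_neg {b u : ℝ} (h : u < 0) :
    affineMap (b, u) = (b + u + 1 / 2, -b) := if_neg (not_le.mpr h)

theorem sqrt_three_mul_self : √3 * √3 = (3 : ℝ) := Real.mul_self_sqrt (by norm_num)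

theorem sqrt_three_pos : (0 : ℝ) < √3 := by positivity

theorem F_affineCoord (p : ℝ × ℝ) :
    F (Real.pi / 3) (affineCoord p) = affineCoord (affineMap p) := by
  obtain ⟨b, u⟩ := p
  have h3 := sqrt_three_mul_self
  have hpos := sqrt_three_pos
  simp only [F, Real.cos_pi_div_three, Real.sin_pi_div_three]
  rcases le_or_gt 0 u with h | h
  · have hs : sgn (affineCoord (b, u)).2 = 1 := if_pos (mul_nonneg hpos.le h)
    rw [hs, affineMap_of_nonneg h, affineCoord_apply, affineCoord_apply]
    ext
    · simp only; linear_combination (1 / 2 * u) * h3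
    · simp only; ring
  · have hs : sgn (affineCoord (b, u)).2 = -1 :=
      if_neg (not_le.mpr (mul_neg_of_pos_of_neg hpos h))
    rw [hs, affineMap_of_neg h, affineCoord_apply, affineCoord_apply]
    ext
    · simp only; linear_combination (1 / 2 * u) * h3
    · simp only; ring

theorem F_iterate_affineCoord (n : ℕ) (p : ℝ × ℝ) :
    (F (Real.pi / 3))^[n] (affineCoord p) = affineCoord (affineMap^[n] p) := by
  have h : Semiconj affineCoord affineMap (F (Real.pi / 3)) := fun p => (F_affineCoord p).symm
  exact (h.iterate_right n p).symm

theorem isPeriodicPt_affineCoord_iff (n : ℕ) (p : ℝ × ℝ) :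
    IsPeriodicPt (F (Real.pi / 3)) n (affineCoord p) ↔ IsPeriodicPt affineMap n p := by
  simp only [IsPeriodicPt, IsFixedPt, F_iterate_affineCoord, EmbeddingLike.apply_eq_iff_eq]

theorem minimalPeriod_affineCoord (p : ℝ × ℝ) :
    minimalPeriod (F (Real.pi / 3)) (affineCoord p) = minimalPeriod affineMap p :=
  minimalPeriod_eq_minimalPeriod_iff.mpr fun n => isPeriodicPt_affineCoord_iff n p

/-- On both branches the image `(b', u')` satisfies `b' + u' - 1 / 2 = u`, so the image reveals
which branch was used; the same quantity picks the preimage in `affineMap_surjective`. -/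
theorem affineMap_injective : Injective affineMap := by
  rintro ⟨b, u⟩ ⟨b', u'⟩ h
  rcases le_or_gt 0 u with h1 | h1 <;> rcases le_or_gt 0 u' with h2 | h2 <;>
  simp only [affineMap_of_nonneg, affineMap_of_neg, h1, h2, Prod.mk.injEq] at h ⊢ <;>
  constructor <;> linarith

theorem affineMap_surjective : Surjective affineMap := by
  rintro ⟨b, u⟩
  rcases le_or_gt 0 (b + u - 1 / 2) with h | h
  · exact ⟨(1 - u, b + u - 1 / 2), by
      rw [affineMap_of_nonneg h]; ext <;> simp only <;> ring⟩
  · exact ⟨(-u, b + u - 1 / 2), by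
      rw [affineMap_of_neg h]; ext <;> simp only <;> ring⟩

theorem F_bijective : Bijective (F (Real.pi / 3)) := by
  have h : F (Real.pi / 3) = affineCoord ∘ affineMap ∘ affineCoord.symm := by
    funext p
    obtain ⟨q, rfl⟩ := affineCoord.surjective p
    simp [F_affineCoord]
  rw [h]
  exact affineCoord.bijective.comp
    (Bijective.comp ⟨affineMap_injective, affineMap_surjective⟩ affineCoord.symm.bijective)

/-! ### Grid, tiles and floor functions in affine coordinates -/

/-- The grid in affine coordinates. -/
def affineGrid : Set (ℝ × ℝ) :=
  {p | (∃ k : ℤ, p.1 = k) ∨ (∃ l : ℤ, p.2 = l) ∨ ∃ m : ℤ, p.1 + p.2 - 1 / 2 = m}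

theorem affineCoord_mem_grid_iff (p : ℝ × ℝ) : affineCoord p ∈ grid ↔ p ∈ affineGrid := by
  obtain ⟨b, u⟩ := p
  have hpos := sqrt_three_pos
  have key : ∀ z : ℝ, √3 * u = √3 * z ↔ u = z := fun z => mul_right_inj' hpos.ne'
  simp only [grid, affineGrid, affineCoord_apply, Set.mem_ofPred_eq, neg_mul, ← mul_neg, key]
  refine or_congr ?_ (or_congr Iff.rfl ?_)
  · exact ⟨fun ⟨k, h⟩ => ⟨k + 1, by push_cast; linarith⟩,
      fun ⟨k, h⟩ => ⟨k - 1, by push_cast; linarith⟩⟩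
  · exact exists_congr fun k => ⟨fun h => by linarith, fun h => by linarith⟩

theorem affineCoord_mem_tile_iff (k l m : ℤ) (b u : ℝ) : affineCoord (b, u) ∈ tile k l m ↔
    ((k : ℝ) < b ∧ b < k + 1) ∧ ((l : ℝ) < u ∧ u < l + 1) ∧
      ((m : ℝ) < b + u - 1 / 2 ∧ b + u - 1 / 2 < m + 1) := by
  have hpos := sqrt_three_pos
  simp only [tile, affineCoord_apply, Set.mem_ofPred_eq, neg_mul, ← mul_neg,
    mul_lt_mul_iff_right₀ hpos]
  refine and_congr ⟨fun h => ⟨by linarith, by linarith⟩, fun h => ⟨by linarith, by linarith⟩⟩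
    (and_congr Iff.rfl
      ⟨fun h => ⟨by linarith, by linarith⟩, fun h => ⟨by linarith, by linarith⟩⟩)

theorem B_affineCoord (b u : ℝ) : B (affineCoord (b, u)) = ⌊b⌋ := by
  rw [B, affineCoord_apply]
  congr 1
  linear_combination (-u / 6) * sqrt_three_mul_self

theorem C_affineCoord (b u : ℝ) : C (affineCoord (b, u)) = ⌊u⌋ := by
  rw [C, affineCoord_apply]
  congr 1
  linear_combination (u / 3) * sqrt_three_mul_self

theorem D_affineCoord (b u : ℝ) : D (affineCoord (b, u)) = ⌊b + u - 1 / 2⌋ := by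
  rw [D, affineCoord_apply]
  congr 1
  linear_combination (u / 6) * sqrt_three_mul_self

theorem affineCoord_mem_criticalLine_iff (p : ℝ × ℝ) :
    affineCoord p ∈ criticalLine ↔ p.2 = 0 := by
  have hpos := sqrt_three_pos
  simp [criticalLine, affineCoord, hpos.ne']

/-- The three families of lines are permuted cyclically: a line of integral `b` goes to one of
integral `u`, that to one of integral `b + u - 1 / 2`, and that back to one of integral `b`. -/
theorem affineMap_mem_affineGrid_iff (p : ℝ × ℝ) :
    affineMap p ∈ affineGrid ↔ p ∈ affineGrid := by
  obtain ⟨b, u⟩ := p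
  simp only [affineGrid, Set.mem_ofPred_eq]
  rcases le_or_gt 0 u with h | h
  · rw [affineMap_of_nonneg h]
    constructor
    · rintro (⟨k, hk⟩ | ⟨k, hk⟩ | ⟨k, hk⟩)
      · exact Or.inr (Or.inr ⟨k, hk⟩)
      · exact Or.inl ⟨1 - k, by push_cast; linarith⟩
      · exact Or.inr (Or.inl ⟨k, by linarith⟩)
    · rintro (⟨k, hk⟩ | ⟨k, hk⟩ | ⟨k, hk⟩)
      · exact Or.inr (Or.inl ⟨1 - k, by push_cast; linarith⟩)
      · exact Or.inr (Or.inr ⟨k, by linarith⟩)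
      · exact Or.inl ⟨k, hk⟩
  · rw [affineMap_of_neg h]
    constructor
    · rintro (⟨k, hk⟩ | ⟨k, hk⟩ | ⟨k, hk⟩)
      · exact Or.inr (Or.inr ⟨k - 1, by push_cast; linarith⟩)
      · exact Or.inl ⟨-k, by push_cast; linarith⟩
      · exact Or.inr (Or.inl ⟨k, by linarith⟩)
    · rintro (⟨k, hk⟩ | ⟨k, hk⟩ | ⟨k, hk⟩)
      · exact Or.inr (Or.inl ⟨-k, by push_cast; linarith⟩)
      · exact Or.inr (Or.inr ⟨k, by linarith⟩)
      · exact Or.inl ⟨k + 1, by push_cast; linarith⟩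

theorem affineMap_iterate_mem_affineGrid_iff (n : ℕ) (p : ℝ × ℝ) :
    affineMap^[n] p ∈ affineGrid ↔ p ∈ affineGrid := by
  induction n generalizing p with
  | zero => rfl
  | succ n ih => rw [iterate_succ_apply, ih, affineMap_mem_affineGrid_iff]

/-! ### The third iterate as a translation up to reflection -/

/-- The point `(b, u)`, reflected in the centre of symmetry when `n` is odd. -/
noncomputable def flipped (n : ℕ) (b u : ℝ) : ℝ × ℝ := if Even n then (b, u) else (1 - b, -u)

/-- `x` exceeds `1`, where ties are broken by the parity of `n`. -/
def Beyond (n : ℕ) (x : ℝ) : Prop := 1 < x ∨ (x = 1 ∧ Odd n)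

theorem flipped_of_even {n : ℕ} (h : Even n) (b u : ℝ) : flipped n b u = (b, u) := if_pos h

theorem flipped_of_odd {n : ℕ} (h : Odd n) (b u : ℝ) : flipped n b u = (1 - b, -u) :=
  if_neg (Nat.not_even_iff_odd.mpr h)

theorem flipped_snd_eq_zero_iff (n : ℕ) (b u : ℝ) : (flipped n b u).2 = 0 ↔ u = 0 := by
  rcases Nat.even_or_odd n with h | h
  · rw [flipped_of_even h]
  · rw [flipped_of_odd h, neg_eq_zero]

theorem Beyond.one_le {n : ℕ} {x : ℝ} (h : Beyond n x) : 1 ≤ x := by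
  rcases h with h | ⟨h, -⟩ <;> linarith

theorem Beyond.one_lt {n : ℕ} {x : ℝ} (h : Beyond n x) (hn : Even n) : 1 < x := by
  rcases h with h | ⟨h, h'⟩
  · exact h
  · exact absurd hn (Nat.not_even_iff_odd.mpr h')

theorem le_one_of_not_beyond {n : ℕ} {x : ℝ} (h : ¬ Beyond n x) : x ≤ 1 := by
  by_contra! h'
  exact h (Or.inl h')

theorem lt_one_of_not_beyond {n : ℕ} {x : ℝ} (h : ¬ Beyond n x) (hn : Odd n) : x < 1 := by
  rcases (le_one_of_not_beyond h).lt_or_eq with h' | h'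
  · exact h'
  · exact absurd (Or.inr ⟨h', hn⟩) h

theorem not_beyond_of_lt {n : ℕ} {x : ℝ} (h : x < 1) : ¬ Beyond n x := by
  rintro (h' | ⟨h', -⟩) <;> linarith

theorem affineMap_iterate_three (p : ℝ × ℝ) :
    affineMap^[3] p = affineMap (affineMap (affineMap p)) := rfl

theorem affineMap_iterate_three_eq {p p₁ p₂ p₃ : ℝ × ℝ} (h₁ : affineMap p = p₁)
    (h₂ : affineMap p₁ = p₂) (h₃ : affineMap p₂ = p₃) : affineMap^[3] p = p₃ := by
  rw [affineMap_iterate_three, h₁, h₂, h₃]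

/-- The third iterate moves points beyond `b = 1` along the first side of the level sets. -/
theorem affineMap_three_of_beyond {n : ℕ} {b u : ℝ} (hu : 0 < u ∨ (u = 0 ∧ Even n))
    (hb : Beyond n b) : affineMap^[3] (flipped n b u) = flipped (n + 1) (b - 1) (u + 1) := by
  rcases Nat.even_or_odd n with hn | hn
  · have hu' : 0 ≤ u := by rcases hu with h | ⟨h, -⟩ <;> linarith
    have hb' := hb.one_lt hn
    rw [flipped_of_even hn, flipped_of_odd hn.add_one]
    refine affineMap_iterate_three_eq (affineMap_of_nonneg hu') (affineMap_of_neg ?_)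
      ((affineMap_of_neg ?_).trans ?_)
    · linarith
    · linarith
    ext <;> simp only <;> ring
  · have hu' : 0 < u := by
      rcases hu with h | ⟨-, h⟩
      · exact h
      · exact absurd h (Nat.not_even_iff_odd.mpr hn)
    have hb' := hb.one_le
    rw [flipped_of_odd hn, flipped_of_even hn.add_one]
    refine affineMap_iterate_three_eq (affineMap_of_neg ?_) (affineMap_of_nonneg ?_)
      ((affineMap_of_nonneg ?_).trans ?_)
    · linarith
    · linarith
    · linarith
    ext <;> simp only <;> ring

/-- The third iterate moves points along the second side of the level sets. -/
theorem affineMap_three_of_not_beyond_of_beyond {n : ℕ} {b u : ℝ}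
    (hu : 0 < u ∨ (u = 0 ∧ Even n)) (hb : ¬ Beyond n b) (hw : Beyond n (b + u - 1 / 2)) :
    affineMap^[3] (flipped n b u) = flipped (n + 1) (b - 1) u := by
  rcases Nat.even_or_odd n with hn | hn
  · have hu' : 0 ≤ u := by rcases hu with h | ⟨h, -⟩ <;> linarith
    have hb' := le_one_of_not_beyond hb
    have hw' := hw.one_lt hn
    rw [flipped_of_even hn, flipped_of_odd hn.add_one]
    refine affineMap_iterate_three_eq (affineMap_of_nonneg hu') (affineMap_of_nonneg ?_)
      ((affineMap_of_neg ?_).trans ?_)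
    · linarith
    · linarith
    ext <;> simp only <;> ring
  · have hu' : 0 < u := by
      rcases hu with h | ⟨-, h⟩
      · exact h
      · exact absurd h (Nat.not_even_iff_odd.mpr hn)
    have hb' := lt_one_of_not_beyond hb hn
    have hw' := hw.one_le
    rw [flipped_of_odd hn, flipped_of_even hn.add_one]
    refine affineMap_iterate_three_eq (affineMap_of_neg ?_) (affineMap_of_neg ?_)
      ((affineMap_of_nonneg ?_).trans ?_)
    · linarith
    · linarith
    · linarith
    ext <;> simp only <;> ring

/-- The third iterate moves points along the third side of the level sets. -/
theorem affineMap_three_of_not_beyond {n : ℕ} {b u : ℝ}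
    (hu : 0 < u ∨ (u = 0 ∧ Even n)) (hb : ¬ Beyond n b) (hw : ¬ Beyond n (b + u - 1 / 2)) :
    affineMap^[3] (flipped n b u) = flipped (n + 1) b (u - 1) := by
  rcases Nat.even_or_odd n with hn | hn
  · have hu' : 0 ≤ u := by rcases hu with h | ⟨h, -⟩ <;> linarith
    have hb' := le_one_of_not_beyond hb
    have hw' := le_one_of_not_beyond hw
    rw [flipped_of_even hn, flipped_of_odd hn.add_one]
    refine affineMap_iterate_three_eq (affineMap_of_nonneg hu') (affineMap_of_nonneg ?_)
      ((affineMap_of_nonneg ?_).trans ?_)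
    · linarith
    · linarith
    ext <;> simp only <;> ring
  · have hu' : 0 < u := by
      rcases hu with h | ⟨-, h⟩
      · exact h
      · exact absurd h (Nat.not_even_iff_odd.mpr hn)
    have hb' := lt_one_of_not_beyond hb hn
    have hw' := lt_one_of_not_beyond hw hn
    rw [flipped_of_odd hn, flipped_of_even hn.add_one]
    refine affineMap_iterate_three_eq (affineMap_of_neg ?_) (affineMap_of_neg ?_)
      ((affineMap_of_neg ?_).trans ?_)
    · linarith
    · linarith
    · linarith
    ext <;> simp only <;> ring

/-! ### Excursions away from the critical line -/

/-- The third iterate of `affineMap` goes from `p` to `q` in `j` steps, off the critical line in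
between. -/
def Excursion (p : ℝ × ℝ) (j : ℕ) (q : ℝ × ℝ) : Prop :=
  affineMap^[3 * j] p = q ∧ ∀ i, 0 < i → i < j → (affineMap^[3 * i] p).2 ≠ 0

theorem Excursion.refl (p : ℝ × ℝ) : Excursion p 0 p :=
  ⟨rfl, fun _ _ h => absurd h (Nat.not_lt_zero _)⟩

theorem excursion_one {p q : ℝ × ℝ} (h : affineMap^[3] p = q) : Excursion p 1 q :=
  ⟨h, fun i h0 h1 => by omega⟩

theorem Excursion.trans {p q r : ℝ × ℝ} {i j : ℕ} (h : Excursion p i q) (hq : q.2 ≠ 0)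
    (h' : Excursion q j r) : Excursion p (i + j) r := by
  have key : ∀ k, affineMap^[3 * (i + k)] p = affineMap^[3 * k] q := fun k => by
    rw [mul_add, add_comm, iterate_add_apply, h.1]
  refine ⟨by rw [key, h'.1], fun k h0 hk => ?_⟩
  rcases lt_trichotomy k i with hki | rfl | hki
  · exact h.2 k h0 hki
  · rwa [h.1]
  · obtain ⟨k, rfl⟩ := Nat.exists_eq_add_of_lt hki
    rw [add_assoc, key]
    exact h'.2 _ (by omega) (by omega)

/-- As `b` drops by one at each step, it is enough to test the last step; at all earlier ones `b` is
then strictly greater than 1 and parity is irrelevant. -/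
theorem excursion_first_side (n k : ℕ) {b u : ℝ} (hu : 0 < u ∨ (u = 0 ∧ Even n))
    (hb : 0 < k → Beyond (n + k - 1) (b - k + 1)) :
    Excursion (flipped n b u) k (flipped (n + k) (b - k) (u + k)) := by
  have hu' : 0 ≤ u := by rcases hu with h | ⟨h, -⟩ <;> linarith
  induction k with
  | zero => simpa using Excursion.refl _
  | succ k ih =>
    have hb' := hb k.succ_pos
    rcases k.eq_zero_or_pos with rfl | hk
    · have hb'' : Beyond n b := by simpa using hb'
      simpa using excursion_one (affineMap_three_of_beyond hu hb'')
    have hk' : (0 : ℝ) < k := by exact_mod_cast hk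
    have h1 := hb'.one_le
    push_cast at hb' h1 ⊢
    have hs := affineMap_three_of_beyond (n := n + k) (b := b - k) (u := u + k)
      (Or.inl (by linarith)) (by
        rw [show n + (k + 1) - 1 = n + k by omega] at hb'
        convert hb' using 1; ring)
    refine (ih fun _ => Or.inl (by linarith)).trans
      (by rw [ne_eq, flipped_snd_eq_zero_iff]; linarith) ?_
    convert excursion_one hs using 2 <;> ring

/-- Both `b` and `b + u - 1 / 2` drop by one at each step. So the first condition need only be
tested at the start, where alone a tie can occur, and the second only at the last step. -/
theorem excursion_second_side (n k : ℕ) {b u : ℝ} (hu : 0 < u) (hb : 0 < k → ¬ Beyond n b)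
    (hw : 0 < k → 1 < b + u - 1 / 2 - k + 1) :
    Excursion (flipped n b u) k (flipped (n + k) (b - k) u) := by
  induction k with
  | zero => simpa using Excursion.refl _
  | succ k ih =>
    have hw' := hw k.succ_pos
    have hb' := hb k.succ_pos
    push_cast at hw' ⊢
    refine (ih (fun _ => hb') fun _ => by linarith).trans
      (by rw [ne_eq, flipped_snd_eq_zero_iff]; exact hu.ne') ?_
    have hbk : ¬ Beyond (n + k) (b - k) := by
      rcases k.eq_zero_or_pos with rfl | hk
      · simpa using hb'
      · have hk' : (0 : ℝ) < k := by exact_mod_cast hk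
        exact not_beyond_of_lt (by linarith [le_one_of_not_beyond hb'])
    have hs := affineMap_three_of_not_beyond_of_beyond (Or.inl hu) hbk (Or.inl (by linarith))
    convert excursion_one hs using 2 <;> ring

/-- Here `b` is constant and the height falls by one each time; being a natural number, it ends at
exactly 0. -/
theorem excursion_third_side (n k : ℕ) {b : ℝ} (hb : b < 1) (hw : b + k - 1 / 2 < 1) :
    Excursion (flipped n b k) k (flipped (n + k) b 0) := by
  induction k generalizing n with
  | zero => simpa using Excursion.refl _
  | succ k ih =>
    push_cast at hw ⊢
    have hs := affineMap_three_of_not_beyond (n := n) (b := b) (u := k + 1)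
      (Or.inl (by positivity)) (not_beyond_of_lt hb) (not_beyond_of_lt (by linarith))
    rw [add_sub_cancel_right] at hs
    rcases k.eq_zero_or_pos with rfl | hk
    · simpa using excursion_one hs
    · have hk' : (0 : ℝ) < k := by exact_mod_cast hk
      rw [show n + (k + 1) = n + 1 + k by ring, add_comm k 1]
      exact (excursion_one hs).trans
        (by rw [ne_eq, flipped_snd_eq_zero_iff]; exact hk'.ne') (ih (n + 1) (by linarith))

/-- The way from a point above the critical line, along the three sides of a level set, back to
the critical line. -/
theorem excursion_flipped {b : ℝ} (l n₁ n₂ : ℕ) (hl : 0 < l + n₁)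
    (h₁ : 0 < n₁ → Beyond (n₁ - 1) (b - n₁ + 1)) (h₂ : 0 < n₂ → ¬ Beyond n₁ (b - n₁))
    (h₃ : 0 < n₂ → 1 < b + l - 1 / 2 - n₂ + 1) (h₄ : b - n₁ - n₂ < 1)
    (h₅ : b + l - 1 / 2 - n₂ < 1) :
    Excursion (b, (l : ℝ)) (n₁ + n₂ + (l + n₁))
      (flipped (n₁ + n₂ + (l + n₁)) (b - n₁ - n₂) 0) := by
  have hpos : (0 : ℝ) < l + n₁ := by exact_mod_cast hl
  have hl' : 0 < (l : ℝ) ∨ ((l : ℝ) = 0 ∧ Even 0) := by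
    rcases l.eq_zero_or_pos with h | h
    · exact Or.inr ⟨by simp [h], Even.zero⟩
    · exact Or.inl (by exact_mod_cast h)
  have e₁ := excursion_first_side 0 n₁ (b := b) hl' (by simpa using h₁)
  have e₂ := excursion_second_side (0 + n₁) n₂ (b := b - n₁) hpos (by simpa using h₂)
    (fun h => by linarith [h₃ h])
  have e₃ := excursion_third_side (0 + n₁ + n₂) (l + n₁) (b := b - n₁ - n₂) h₄
    (by push_cast; linarith)
  push_cast at e₃
  have e := (e₁.trans (by rw [ne_eq, flipped_snd_eq_zero_iff]; exact hpos.ne') e₂).trans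
    (by rw [ne_eq, flipped_snd_eq_zero_iff]; exact hpos.ne') e₃
  simpa [flipped_of_even Even.zero] using e

/-- The first return to the critical line from `(t, 0)` with `1 < t`. -/
theorem excursion_right {t : ℝ} (n₁ n₂ : ℕ) (hl : 0 < n₁)
    (h₁ : Beyond (n₁ - 1) (t - n₁ + 1)) (h₂ : 0 < n₂ → ¬ Beyond n₁ (t - n₁))
    (h₃ : 0 < n₂ → 1 < t - 1 / 2 - n₂ + 1) (h₄ : t - n₁ - n₂ < 1)
    (h₅ : t - 1 / 2 - n₂ < 1) :
    Excursion (t, 0) (2 * n₁ + n₂) (flipped n₂ (t - n₁ - n₂) 0) := by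
  have e := excursion_flipped (b := t) 0 n₁ n₂ (by omega) (fun _ => h₁) h₂ (by simpa using h₃) h₄
    (by simpa using h₅)
  -- The climb and the descent have the same length, so only the parity of the middle side decides
  -- whether the endpoint is reflected.
  have hf : ∀ b u, flipped (n₁ + n₂ + (0 + n₁)) b u = flipped n₂ b u := fun b u => by
    have : Even (n₁ + n₂ + (0 + n₁)) ↔ Even n₂ := by grind
    simp only [flipped, this]
  rw [hf] at e
  convert e using 1
  · simp
  · ring

/-- The first return to the critical line from `(t, 0)` with `t ≤ 1`. -/
theorem excursion_left {t : ℝ} (n₁ n₂ : ℕ) (ht : t ≤ 1)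
    (h₁ : 0 < n₁ → Beyond (n₁ - 1) (1 - t - n₁ + 1)) (h₂ : 0 < n₂ → ¬ Beyond n₁ (1 - t - n₁))
    (h₃ : 0 < n₂ → 1 < 3 / 2 - t - n₂ + 1) (h₄ : 1 - t - n₁ - n₂ < 1)
    (h₅ : 3 / 2 - t - n₂ < 1) :
    Excursion (t, 0) (2 * n₁ + n₂ + 2) (flipped (n₂ + 1) (1 - t - n₁ - n₂) 0) := by
  -- For `t ≤ 1` the first step is already of the third kind and goes below the line; after
  -- reflection the excursion continues from `(1 - t, 1)`.
  have hs := affineMap_three_of_not_beyond (n := 0) (b := t) (u := 0) (Or.inr ⟨rfl, Even.zero⟩)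
    (by rintro (h | ⟨-, h⟩)
        · linarith
        · simp at h)
    (not_beyond_of_lt (by linarith))
  rw [flipped_of_even Even.zero, flipped_of_odd (by decide), zero_sub, neg_neg] at hs
  have e := excursion_flipped (b := 1 - t) 1 n₁ n₂ (by omega) h₁ h₂
    (fun h => by push_cast; linarith [h₃ h]) h₄ (by push_cast; linarith)
  have hf : ∀ b u, flipped (n₁ + n₂ + (1 + n₁)) b u = flipped (n₂ + 1) b u := fun b u => by
    have : Even (n₁ + n₂ + (1 + n₁)) ↔ Even (n₂ + 1) := by grind
    simp only [flipped, this]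
  rw [hf, Nat.cast_one] at e
  convert (excursion_one hs).trans (by simp) e using 1
  ring

/-! ### Visits to horizontal grid lines occur at multiples of three -/

/-- Points on horizontal grid lines that are not midpoints of a horizontal segment. -/
def horizontalPts : Set (ℝ × ℝ) :=
  {p | (∃ l : ℤ, p.2 = l) ∧ ∀ k : ℤ, p.1 ≠ k + 1 / 2}

/-- The image lies on a line of the third family, and such a line meets horizontal grid lines only
at the excluded half-integral `b`. -/
theorem affineMap_notMem_horizontalPts {p : ℝ × ℝ} (h : p ∈ horizontalPts) :
    affineMap p ∉ horizontalPts := by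
  obtain ⟨b, u⟩ := p
  obtain ⟨⟨l, hl⟩, -⟩ := h
  simp only at hl
  rintro ⟨⟨k, hk⟩, h'⟩
  rcases le_or_gt 0 u with hu | hu
  · rw [affineMap_of_nonneg hu] at hk h'
    simp only at hk h'
    exact h' (-k + l) (by push_cast; linarith)
  · rw [affineMap_of_neg hu] at hk h'
    simp only at hk h'
    exact h' (-k + l) (by push_cast; linarith)

theorem affineMap_two_notMem_horizontalPts {p : ℝ × ℝ} (h : p ∈ horizontalPts) :
    affineMap^[2] p ∉ horizontalPts := by
  obtain ⟨b, u⟩ := p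
  obtain ⟨⟨l, hl⟩, h⟩ := h
  simp only at hl h
  rintro ⟨⟨k, hk⟩, -⟩
  change (affineMap (affineMap (b, u))).2 = k at hk
  rcases le_or_gt 0 u with hu | hu
  · rw [affineMap_of_nonneg hu] at hk
    rcases le_or_gt 0 (1 - b) with hv | hv
    · rw [affineMap_of_nonneg hv] at hk
      exact h (1 - k - l) (by push_cast; linarith)
    · rw [affineMap_of_neg hv] at hk
      exact h (- k - l) (by push_cast; linarith)
  · rw [affineMap_of_neg hu] at hk
    rcases le_or_gt 0 (-b) with hv | hv
    · rw [affineMap_of_nonneg hv] at hk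
      exact h (-k - l) (by push_cast; linarith)
    · rw [affineMap_of_neg hv] at hk
      exact h (-1 - k - l) (by push_cast; linarith)

/-- Three rotations by a sixth of a turn make a half turn: `b` and `u` become an integer minus
themselves, whichever branches are taken. -/
theorem affineMap_three_mem_horizontalPts {p : ℝ × ℝ} (h : p ∈ horizontalPts) :
    affineMap^[3] p ∈ horizontalPts := by
  obtain ⟨b, u⟩ := p
  obtain ⟨⟨l, hl⟩, h⟩ := h
  simp only at hl h
  have key : ∀ c v : ℝ, (∃ k : ℤ, c = k - b) → (∃ k : ℤ, v = k) → (c, v) ∈ horizontalPts := by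
    rintro c v ⟨k, hk⟩ hv
    exact ⟨hv, fun k' hk' => h (k - k' - 1) (by push_cast; simp only at hk'; linarith)⟩
  rw [affineMap_iterate_three]
  rcases le_or_gt 0 u with hu | hu
  · rw [affineMap_of_nonneg hu]
    rcases le_or_gt 0 (1 - b) with hv | hv
    · rw [affineMap_of_nonneg hv]
      rcases le_or_gt 0 (1 - (b + u - 1 / 2)) with hw | hw
      · rw [affineMap_of_nonneg hw]
        exact key _ _ ⟨1, by push_cast; linarith⟩ ⟨1 - l, by push_cast; linarith⟩
      · rw [affineMap_of_neg hw]
        exact key _ _ ⟨2, by push_cast; linarith⟩ ⟨-l, by push_cast; linarith⟩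
    · rw [affineMap_of_neg hv]
      rcases le_or_gt 0 (-(b + u - 1 / 2)) with hw | hw
      · rw [affineMap_of_nonneg hw]
        exact key _ _ ⟨1, by push_cast; linarith⟩ ⟨-l, by push_cast; linarith⟩
      · rw [affineMap_of_neg hw]
        exact key _ _ ⟨2, by push_cast; linarith⟩ ⟨-1 - l, by push_cast; linarith⟩
  · rw [affineMap_of_neg hu]
    rcases le_or_gt 0 (-b) with hv | hv
    · rw [affineMap_of_nonneg hv]
      rcases le_or_gt 0 (1 - (b + u + 1 / 2)) with hw | hw
      · rw [affineMap_of_nonneg hw]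
        exact key _ _ ⟨0, by push_cast; linarith⟩ ⟨1 - l, by push_cast; linarith⟩
      · rw [affineMap_of_neg hw]
        exact key _ _ ⟨1, by push_cast; linarith⟩ ⟨-l, by push_cast; linarith⟩
    · rw [affineMap_of_neg hv]
      rcases le_or_gt 0 (-(b + u + 1 / 2)) with hw | hw
      · rw [affineMap_of_nonneg hw]
        exact key _ _ ⟨0, by push_cast; linarith⟩ ⟨-l, by push_cast; linarith⟩
      · rw [affineMap_of_neg hw]
        exact key _ _ ⟨1, by push_cast; linarith⟩ ⟨-1 - l, by push_cast; linarith⟩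

theorem affineMap_three_mul_mem_horizontalPts {p : ℝ × ℝ} (h : p ∈ horizontalPts) (n : ℕ) :
    affineMap^[3 * n] p ∈ horizontalPts := by
  induction n with
  | zero => exact h
  | succ n ih =>
    rw [mul_add, add_comm, iterate_add_apply]
    exact affineMap_three_mem_horizontalPts ih

theorem three_dvd_of_isPeriodicPt {p : ℝ × ℝ} (h : p ∈ horizontalPts) {n : ℕ}
    (hn : IsPeriodicPt affineMap n p) : 3 ∣ n := by
  have hq := affineMap_three_mul_mem_horizontalPts h (n / 3)
  have hr : n % 3 < 3 := Nat.mod_lt _ (by norm_num)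
  have key : affineMap^[n % 3] (affineMap^[3 * (n / 3)] p) = p := by
    rw [← iterate_add_apply, Nat.mod_add_div]; exact hn
  interval_cases hm : n % 3
  · exact Nat.dvd_of_mod_eq_zero hm
  · exact absurd (by rw [← key] at h; exact h) (affineMap_notMem_horizontalPts hq)
  · exact absurd (by rw [← key] at h; exact h) (affineMap_two_notMem_horizontalPts hq)

/-- The third iterate of `affineMap` goes from `q` to `r` in `j` steps, without meeting `p` in
between. -/
def PathAvoiding (p q : ℝ × ℝ) (j : ℕ) (r : ℝ × ℝ) : Prop :=
  affineMap^[3 * j] q = r ∧ ∀ i, 0 < i → i < j → affineMap^[3 * i] q ≠ p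

theorem Excursion.pathAvoiding {q r : ℝ × ℝ} {j : ℕ} (h : Excursion q j r) (t : ℝ) :
    PathAvoiding (t, 0) q j r :=
  ⟨h.1, fun i h0 hi he => h.2 i h0 hi (by rw [he])⟩

theorem PathAvoiding.trans {p q r s : ℝ × ℝ} {i j : ℕ} (h : PathAvoiding p q i r) (hr : r ≠ p)
    (h' : PathAvoiding p r j s) : PathAvoiding p q (i + j) s := by
  have key : ∀ k, affineMap^[3 * (i + k)] q = affineMap^[3 * k] r := fun k => by
    rw [mul_add, add_comm, iterate_add_apply, h.1]
  refine ⟨by rw [key, h'.1], fun k h0 hk => ?_⟩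
  rcases lt_trichotomy k i with hki | rfl | hki
  · exact h.2 k h0 hki
  · rwa [h.1]
  · obtain ⟨k, rfl⟩ := Nat.exists_eq_add_of_lt hki
    rw [add_assoc, key]
    exact h'.2 _ (by omega) (by omega)

/-- A period is a multiple of three, so a smaller one would be a return under the third iterate
before step `j`. -/
theorem PathAvoiding.minimalPeriod {p : ℝ × ℝ} {j : ℕ} (h : PathAvoiding p p j p) (hj : 0 < j)
    (hp : p ∈ horizontalPts) : minimalPeriod affineMap p = 3 * j := by
  have hper : IsPeriodicPt affineMap (3 * j) p := h.1
  have hpos := hper.minimalPeriod_pos (by omega)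
  have hle := hper.minimalPeriod_le (by omega)
  have hmin := isPeriodicPt_minimalPeriod affineMap p
  obtain ⟨i, hi⟩ := three_dvd_of_isPeriodicPt hp hmin
  rw [hi] at hmin hpos hle ⊢
  by_contra hne
  exact h.2 i (by omega) (by omega) hmin

theorem excursion_right_of_eq {t t' : ℝ} {j : ℕ} (n₁ n₂ : ℕ) (hl : 0 < n₁)
    (h₁ : Beyond (n₁ - 1) (t - n₁ + 1)) (h₂ : 0 < n₂ → ¬ Beyond n₁ (t - n₁))
    (h₃ : 0 < n₂ → 1 < t - 1 / 2 - n₂ + 1) (h₄ : t - n₁ - n₂ < 1)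
    (h₅ : t - 1 / 2 - n₂ < 1) (hj : j = 2 * n₁ + n₂)
    (ht' : t' = if Even n₂ then t - n₁ - n₂ else 1 - (t - n₁ - n₂)) :
    Excursion (t, 0) j (t', 0) := by
  convert excursion_right n₁ n₂ hl h₁ h₂ h₃ h₄ h₅ using 1
  rw [ht']
  split_ifs with h <;> simp [flipped, h]

theorem excursion_left_of_eq {t t' : ℝ} {j : ℕ} (n₁ n₂ : ℕ) (ht : t ≤ 1)
    (h₁ : 0 < n₁ → Beyond (n₁ - 1) (1 - t - n₁ + 1)) (h₂ : 0 < n₂ → ¬ Beyond n₁ (1 - t - n₁))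
    (h₃ : 0 < n₂ → 1 < 3 / 2 - t - n₂ + 1) (h₄ : 1 - t - n₁ - n₂ < 1)
    (h₅ : 3 / 2 - t - n₂ < 1) (hj : j = 2 * n₁ + n₂ + 2)
    (ht' : t' = if Even n₂ then 1 - (1 - t - n₁ - n₂) else 1 - t - n₁ - n₂) :
    Excursion (t, 0) j (t', 0) := by
  convert excursion_left n₁ n₂ ht h₁ h₂ h₃ h₄ h₅ using 1
  rw [ht']
  split_ifs with h
  · rw [flipped_of_odd h.add_one, neg_zero]
  · rw [flipped_of_even (Nat.not_even_iff_odd.mp h).add_one]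

theorem mk_zero_mem_horizontalPts {t s : ℝ} (m : ℤ) (ht : t = m + s) (h₀ : -1 / 2 < s)
    (h₁ : s < 1 / 2) : (t, (0 : ℝ)) ∈ horizontalPts := by
  refine ⟨⟨0, by simp⟩, fun k hk => ?_⟩
  simp only at hk
  have h2 : (m : ℝ) < k + 1 := by linarith
  have h3 : (k : ℝ) < m := by linarith
  norm_cast at h2 h3
  omega

theorem Excursion.minimalPeriod {t : ℝ} {j : ℕ} (h : Excursion (t, 0) j (t, 0)) (hj : 0 < j)
    (hp : (t, (0 : ℝ)) ∈ horizontalPts) : minimalPeriod affineMap (t, 0) = 3 * j :=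
  (h.pathAvoiding t).minimalPeriod hj hp

theorem Excursion.minimalPeriod_eq {p q : ℝ × ℝ} {j N : ℕ} (h : Excursion p j q) (hN : 0 < N)
    (hp : Function.minimalPeriod affineMap p = N) : Function.minimalPeriod affineMap q = N := by
  rw [← h.1, minimalPeriod_apply_iterate, hp]
  exact minimalPeriod_pos_iff_mem_periodicPts.mp (hp ▸ hN)

/-! ### Periods of points of the critical line -/

theorem minimalPeriod_even_pos (n : ℕ) :
    minimalPeriod affineMap (2 * n + 2, 0) = 18 * n + 15 := by
  have hn : (0 : ℝ) ≤ n := n.cast_nonneg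
  have e : Excursion ((2 * n + 2 : ℝ), 0) (6 * n + 5) (2 * n + 2, 0) :=
    excursion_right_of_eq (2 * n + 2) (2 * n + 1) (by omega)
      -- At the last step of the climb `b` is exactly 1; the step index `2 * n + 1` is odd, so the
      -- tie counts as beyond.
      (Or.inr ⟨by push_cast; ring, ⟨n, by omega⟩⟩)
      (fun _ => not_beyond_of_lt (by push_cast; linarith)) (fun _ => by push_cast; linarith)
      (by push_cast; linarith) (by push_cast; linarith) (by ring)
      (by rw [if_neg (by grind)]; push_cast; ring)
  rw [e.minimalPeriod (by omega)
    (mk_zero_mem_horizontalPts (2 * n + 2) (s := 0) (by simp) (by norm_num) (by norm_num))]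
  ring

theorem minimalPeriod_even_nonpos (n : ℕ) :
    minimalPeriod affineMap (-2 * n, 0) = 18 * n + 9 := by
  have hn : (0 : ℝ) ≤ n := n.cast_nonneg
  have e : Excursion ((-2 * n : ℝ), 0) (6 * n + 3) (-2 * n, 0) :=
    excursion_left_of_eq (2 * n) (2 * n + 1) (by linarith)
      (fun _ => Or.inl (by push_cast; linarith))
      (fun _ => by rintro (h | ⟨-, h⟩)
                   · push_cast at h; linarith
                   · exact absurd h (by grind)) (fun _ => by push_cast; linarith)
      (by push_cast; linarith) (by push_cast; linarith) (by ring)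
      (by rw [if_neg (by grind)]; push_cast; ring)
  rw [e.minimalPeriod (by omega)
    (mk_zero_mem_horizontalPts (-2 * n) (s := 0) (by simp) (by norm_num) (by norm_num))]
  ring

/-- The two half-unit intervals are exchanged by the first return, in `6 * n` and `6 * n + 2` steps.
The closed end `g = 1 / 2` accounts for the odd integers. -/
theorem minimalPeriod_short_edge (n : ℕ) {g : ℝ} (h₀ : 0 < g) (h₁ : g ≤ 1 / 2) :
    minimalPeriod affineMap (2 * n + 1 / 2 + g, 0) = 36 * n + 6 ∧
      minimalPeriod affineMap (1 / 2 + g - 2 * n, 0) = 36 * n + 6 := by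
  have hn : (0 : ℝ) ≤ n := n.cast_nonneg
  have e' : Excursion ((1 / 2 + g - 2 * n : ℝ), 0) (6 * n + 2) (2 * n + 1 / 2 + g, 0) :=
    excursion_left_of_eq (2 * n) (2 * n) (by linarith)
      (fun _ => by
        rcases h₁.lt_or_eq with h | h
        · exact Or.inl (by push_cast; linarith)
        · exact Or.inr ⟨by push_cast; linarith, ⟨n - 1, by omega⟩⟩)
      (fun _ => not_beyond_of_lt (by push_cast; linarith)) (fun _ => by push_cast; linarith)
      (by push_cast; linarith) (by push_cast; linarith) (by ring)
      (by rw [if_pos (by grind)]; push_cast; ring)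
  have hmem : ((2 * n + 1 / 2 + g : ℝ), (0 : ℝ)) ∈ horizontalPts :=
    mk_zero_mem_horizontalPts (2 * n + 1) (s := g - 1 / 2) (by push_cast; ring) (by linarith)
      (by linarith)
  -- For `n = 0` the two intervals coincide and a single excursion of two steps already closes up.
  rcases n.eq_zero_or_pos with rfl | hpos
  · have e₀ : Excursion ((2 * (0 : ℕ) + 1 / 2 + g : ℝ), 0) 2 (2 * (0 : ℕ) + 1 / 2 + g, 0) := by
      simpa using e'
    have hm := e₀.minimalPeriod (by omega) hmem
    exact ⟨hm, by simpa using hm⟩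
  have hn' : (1 : ℝ) ≤ n := by exact_mod_cast hpos
  have e : Excursion ((2 * n + 1 / 2 + g : ℝ), 0) (6 * n) (1 / 2 + g - 2 * n, 0) :=
    excursion_right_of_eq (2 * n) (2 * n) (by omega)
      (Or.inl (by push_cast; linarith))
      (fun _ => by
        rintro (h | ⟨-, h⟩)
        · push_cast at h; linarith
        · exact absurd h (by grind)) (fun _ => by push_cast; linarith)
      (by push_cast; linarith) (by push_cast; linarith) (by ring)
      (by rw [if_pos (by grind)]; push_cast; ring)
  have hm : minimalPeriod affineMap (2 * n + 1 / 2 + g, 0) = 36 * n + 6 := by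
    rw [((e.pathAvoiding _).trans (by simp only [ne_eq, Prod.mk.injEq, and_true]; intro h; linarith)
      (e'.pathAvoiding _)).minimalPeriod (by omega) hmem]
    ring
  exact ⟨hm, e.minimalPeriod_eq (by omega) hm⟩

/-- The first return permutes the six points cyclically; the return times add up to `36 * n + 24`.
-/
theorem minimalPeriod_long_edge (n : ℕ) {g : ℝ} (h₀ : 0 < g) (h₁ : g < 1 / 2) :
    minimalPeriod affineMap (2 * n + 2 + g, 0) = 108 * n + 72 ∧
      minimalPeriod affineMap (2 * n + 2 - g, 0) = 108 * n + 72 ∧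
      minimalPeriod affineMap (2 * n + 1 + g, 0) = 108 * n + 72 ∧
      minimalPeriod affineMap (g - 2 * n, 0) = 108 * n + 72 ∧
      minimalPeriod affineMap (-2 * n - g, 0) = 108 * n + 72 ∧
      minimalPeriod affineMap (g - 2 * n - 1, 0) = 108 * n + 72 := by
  have hn : (0 : ℝ) ≤ n := n.cast_nonneg
  have e₀ : Excursion ((2 * n + 2 + g : ℝ), 0) (6 * n + 5) (2 * n + 2 - g, 0) :=
    excursion_right_of_eq (2 * n + 2) (2 * n + 1) (by omega)
      (Or.inl (by push_cast; linarith))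
      (fun _ => not_beyond_of_lt (by push_cast; linarith)) (fun _ => by push_cast; linarith)
      (by push_cast; linarith) (by push_cast; linarith) (by ring)
      (by rw [if_neg (by grind)]; push_cast; ring)
  have e₁ : Excursion ((2 * n + 2 - g : ℝ), 0) (6 * n + 3) (2 * n + 1 + g, 0) :=
    excursion_right_of_eq (2 * n + 1) (2 * n + 1) (by omega)
      (Or.inl (by push_cast; linarith))
      (fun _ => not_beyond_of_lt (by push_cast; linarith)) (fun _ => by push_cast; linarith)
      (by push_cast; linarith) (by push_cast; linarith) (by ring)
      (by rw [if_neg (by grind)]; push_cast; ring)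
  have e₂ : Excursion ((2 * n + 1 + g : ℝ), 0) (6 * n + 2) (g - 2 * n, 0) :=
    excursion_right_of_eq (2 * n + 1) (2 * n) (by omega)
      (Or.inl (by push_cast; linarith))
      (fun _ => not_beyond_of_lt (by push_cast; linarith)) (fun _ => by push_cast; linarith)
      (by push_cast; linarith) (by push_cast; linarith) (by ring)
      (by rw [if_pos (by grind)]; push_cast; ring)
  have e₃ : Excursion ((g - 2 * n : ℝ), 0) (6 * n + 3) (-2 * n - g, 0) :=
    excursion_left_of_eq (2 * n) (2 * n + 1) (by linarith)
      (fun _ => Or.inl (by push_cast; linarith))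
      (fun _ => not_beyond_of_lt (by push_cast; linarith)) (fun _ => by push_cast; linarith)
      (by push_cast; linarith) (by push_cast; linarith) (by ring)
      (by rw [if_neg (by grind)]; push_cast; ring)
  have e₄ : Excursion ((-2 * n - g : ℝ), 0) (6 * n + 5) (g - 2 * n - 1, 0) :=
    excursion_left_of_eq (2 * n + 1) (2 * n + 1) (by linarith)
      (fun _ => Or.inl (by push_cast; linarith))
      (fun _ => not_beyond_of_lt (by push_cast; linarith)) (fun _ => by push_cast; linarith)
      (by push_cast; linarith) (by push_cast; linarith) (by ring)
      (by rw [if_neg (by grind)]; push_cast; ring)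
  have e₅ : Excursion ((g - 2 * n - 1 : ℝ), 0) (6 * n + 6) (2 * n + 2 + g, 0) :=
    excursion_left_of_eq (2 * n + 1) (2 * n + 2) (by linarith)
      (fun _ => Or.inl (by push_cast; linarith))
      (fun _ => not_beyond_of_lt (by push_cast; linarith)) (fun _ => by push_cast; linarith)
      (by push_cast; linarith) (by push_cast; linarith) (by ring)
      (by rw [if_pos (by grind)]; push_cast; ring)
  have hmem : ((2 * n + 2 + g : ℝ), (0 : ℝ)) ∈ horizontalPts :=
    mk_zero_mem_horizontalPts (2 * n + 2) (s := g) (by push_cast; ring) (by linarith)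
      (by linarith)
  -- The base point is the rightmost of the six, so the other five are told apart from it by an
  -- inequality.
  have hne : ∀ s : ℝ, s < 2 * n + 2 + g → (s, (0 : ℝ)) ≠ (2 * n + 2 + g, 0) := by
    intro s hs h
    exact hs.ne (Prod.mk.inj h).1
  have hm : minimalPeriod affineMap (2 * n + 2 + g, 0) = 108 * n + 72 := by
    have path := ((((((e₀.pathAvoiding (2 * n + 2 + g)).trans (hne _ (by linarith))
      (e₁.pathAvoiding _)).trans (hne _ (by linarith))
      (e₂.pathAvoiding _)).trans (hne _ (by linarith))
      (e₃.pathAvoiding _)).trans (hne _ (by linarith))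
      (e₄.pathAvoiding _)).trans (hne _ (by linarith))
      (e₅.pathAvoiding _))
    rw [path.minimalPeriod (by omega) hmem]
    ring
  have hN : 0 < 108 * n + 72 := by omega
  have hm₁ := e₀.minimalPeriod_eq hN hm
  have hm₂ := e₁.minimalPeriod_eq hN hm₁
  have hm₃ := e₂.minimalPeriod_eq hN hm₂
  have hm₄ := e₃.minimalPeriod_eq hN hm₃
  exact ⟨hm, hm₁, hm₂, hm₃, hm₄, e₄.minimalPeriod_eq hN hm₄⟩

/-- The periods of the points of the grid. -/
def gridPeriods : Set ℕ :=
  {N | ∃ n : ℕ, N ∈ ({36 * n + 6, 18 * n + 9, 18 * n + 15, 108 * n + 72} : Set ℕ)}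

/-- Sort `t` by its floor and fractional part. Even integers are fixed by the return map. Odd
integers, and even floors with fractional part above one half, belong to two-interval cycles (one
interval when `n = 0`). All remaining points belong to six-interval cycles. -/
theorem minimalPeriod_mem_gridPeriods_of_criticalLine {t : ℝ}
    (ht : (t, (0 : ℝ)) ∈ horizontalPts) :
    minimalPeriod affineMap (t, 0) ∈ gridPeriods := by
  obtain ⟨s, g, hg0, hg1, rfl⟩ : ∃ (s : ℤ) (g : ℝ), 0 ≤ g ∧ g < 1 ∧ t = s + g :=
    ⟨⌊t⌋, Int.fract t, Int.fract_nonneg t, Int.fract_lt_one t, (Int.floor_add_fract t).symm⟩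
  have hhalf : g ≠ 1 / 2 := fun h => ht.2 s (by simp only; rw [h])
  have short : ∀ (n : ℕ) (g' : ℝ), 0 < g' → g' ≤ 1 / 2 →
      (s + g = 2 * n + 1 / 2 + g' ∨ s + g = 1 / 2 + g' - 2 * n) →
      minimalPeriod affineMap (s + g, 0) ∈ gridPeriods := by
    intro n g' h0 h1 h
    have hs := minimalPeriod_short_edge n h0 h1
    rcases h with h | h
    · rw [h]; exact ⟨n, Or.inl hs.1⟩
    · rw [h]; exact ⟨n, Or.inl hs.2⟩
  have long : ∀ (n : ℕ) (g' : ℝ), 0 < g' → g' < 1 / 2 →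
      (s + g = 2 * n + 2 + g' ∨ s + g = 2 * n + 2 - g' ∨ s + g = 2 * n + 1 + g' ∨
        s + g = g' - 2 * n ∨ s + g = -2 * n - g' ∨ s + g = g' - 2 * n - 1) →
      minimalPeriod affineMap (s + g, 0) ∈ gridPeriods := by
    intro n g' h0 h1 h
    refine ⟨n, ?_⟩
    simp only [Set.mem_insert_iff, Set.mem_singleton_iff]
    right; right; right
    obtain ⟨a0, a1, a2, a3, a4, a5⟩ := minimalPeriod_long_edge n h0 h1
    rcases h with h | h | h | h | h | h <;> rw [h] <;> assumption
  rcases hg0.eq_or_lt with hg | hg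
  · subst hg
    rw [add_zero] at *
    obtain ⟨n, hn | hn | hn | hn⟩ : ∃ n : ℕ, s = 2 * n + 2 ∨ s = -2 * n ∨ s = 2 * n + 1 ∨
        s = 1 - 2 * n := by
      rcases Int.even_or_odd' s with ⟨k, hk | hk⟩ <;> rcases le_or_gt k 0 with _ | _
      · exact ⟨(-k).toNat, by omega⟩
      · exact ⟨(k - 1).toNat, by omega⟩
      · exact ⟨(-k).toNat, by omega⟩
      · exact ⟨k.toNat, by omega⟩
    · subst hn
      refine ⟨n, Or.inr (Or.inr (Or.inl ?_))⟩
      exact_mod_cast minimalPeriod_even_pos n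
    · subst hn
      refine ⟨n, Or.inr (Or.inl ?_)⟩
      have := minimalPeriod_even_nonpos n
      push_cast
      exact this
    · exact short n (1 / 2) (by norm_num) le_rfl (Or.inl (by rw [hn]; push_cast; ring))
    · exact short n (1 / 2) (by norm_num) le_rfl (Or.inr (by rw [hn]; push_cast; ring))
  · rcases lt_or_gt_of_ne hhalf with h | h
    · obtain ⟨n, hn | hn | hn | hn⟩ : ∃ n : ℕ, s = 2 * n + 2 ∨ s = -2 * n ∨ s = 2 * n + 1 ∨
          s = - 2 * n - 1 := by
        rcases Int.even_or_odd' s with ⟨k, hk | hk⟩ <;> rcases lt_trichotomy k 0 with h | h | h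
        · exact ⟨(-k).toNat, by omega⟩
        · exact ⟨(-k).toNat, by omega⟩
        · exact ⟨(k - 1).toNat, by omega⟩
        · exact ⟨(-k - 1).toNat, by omega⟩
        · exact ⟨k.toNat, by omega⟩
        · exact ⟨k.toNat, by omega⟩
      all_goals
        refine long n g hg h ?_
        rw [hn]
        push_cast
      · left; ring
      · right; right; right; left; ring
      · right; right; left; ring
      · right; right; right; right; right; ring
    · obtain ⟨n, hn | hn | hn | hn⟩ : ∃ n : ℕ, s = 2 * n ∨ s = -2 * n ∨ s = 2 * n + 1 ∨
          s = - 2 * n - 1 := by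
        rcases Int.even_or_odd' s with ⟨k, hk | hk⟩ <;> rcases lt_trichotomy k 0 with h | h | h
        · exact ⟨(-k).toNat, by omega⟩
        · exact ⟨(-k).toNat, by omega⟩
        · exact ⟨k.toNat, by omega⟩
        · exact ⟨(-k - 1).toNat, by omega⟩
        · exact ⟨k.toNat, by omega⟩
        · exact ⟨k.toNat, by omega⟩
      · exact short n (g - 1 / 2) (by linarith) (by linarith)
          (Or.inl (by rw [hn]; push_cast; ring))
      · exact short n (g - 1 / 2) (by linarith) (by linarith)
          (Or.inr (by rw [hn]; push_cast; ring))
      · exact long n (1 - g) (by linarith) (by linarith)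
          (Or.inr (Or.inl (by rw [hn]; push_cast; ring)))
      · refine long n (1 - g) (by linarith) (by linarith) ?_
        right; right; right; right; left
        rw [hn]; push_cast; ring

/-! ### Grid points reach the critical line -/

/-- The potential `2 * ⌈b⌉₊ + ⌈b + l - 1 / 2⌉₊ + l` decreases under each of the three moves. The
factor 2 pays for the climb, which lowers `b` but raises `l`. -/
theorem exists_iterate_flipped_criticalLine (N : ℕ) : ∀ (n l : ℕ) (b : ℝ),
    2 * ⌈b⌉₊ + ⌈b + l - 1 / 2⌉₊ + l ≤ N →
      ∃ j, (affineMap^[3 * j] (flipped n b l)).2 = 0 := by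
  induction N with
  | zero =>
    intro n l b h
    have hl : l = 0 := by omega
    exact ⟨0, by simp [flipped_snd_eq_zero_iff, hl]⟩
  | succ N ih =>
    intro n l b h
    rcases l.eq_zero_or_pos with rfl | hl
    · exact ⟨0, by simp [flipped_snd_eq_zero_iff]⟩
    have hl' : (0 : ℝ) < l := by exact_mod_cast hl
    have next : ∀ (b' : ℝ) (l' : ℕ), affineMap^[3] (flipped n b l) = flipped (n + 1) b' l' →
        2 * ⌈b'⌉₊ + ⌈b' + l' - 1 / 2⌉₊ + l' ≤ N →
        ∃ j, (affineMap^[3 * j] (flipped n b l)).2 = 0 := by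
      intro b' l' he hle
      obtain ⟨j, hj⟩ := ih (n + 1) l' b' hle
      exact ⟨j + 1, by rwa [mul_add, mul_one, iterate_add_apply, he]⟩
    have ceil_sub : ∀ x : ℝ, ⌈x - 1⌉₊ = ⌈x⌉₊ - 1 := fun x => Nat.ceil_sub_one x
    have ceil_pos : ∀ x : ℝ, 1 ≤ x → 0 < ⌈x⌉₊ := fun x hx => Nat.ceil_pos.mpr (by linarith)
    by_cases hb : Beyond n b
    · refine next (b - 1) (l + 1) ?_ ?_
      · rw [affineMap_three_of_beyond (Or.inl hl') hb]; push_cast; rfl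
      · have h1 := ceil_pos b hb.one_le
        rw [ceil_sub, show b - 1 + ((l + 1 : ℕ) : ℝ) - 1 / 2 = b + l - 1 / 2 by push_cast; ring]
        omega
    · by_cases hw : Beyond n (b + l - 1 / 2)
      · refine next (b - 1) l (affineMap_three_of_not_beyond_of_beyond (Or.inl hl') hb hw) ?_
        have h1 := ceil_pos _ hw.one_le
        rw [ceil_sub, show b - 1 + (l : ℝ) - 1 / 2 = b + l - 1 / 2 - 1 by ring, ceil_sub]
        omega
      · obtain ⟨l, rfl⟩ : ∃ l', l = l' + 1 := ⟨l - 1, by omega⟩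
        refine next b l ?_ ?_
        · rw [affineMap_three_of_not_beyond (Or.inl hl') hb hw]; push_cast
          rw [add_sub_cancel_right]
        · have h1 : ⌈b + (l : ℝ) - 1 / 2⌉₊ ≤ ⌈b + ((l + 1 : ℕ) : ℝ) - 1 / 2⌉₊ :=
            Nat.ceil_mono (by push_cast; linarith)
          omega

theorem exists_iterate_criticalLine_of_horizontalPts {p : ℝ × ℝ} (hp : p ∈ horizontalPts) :
    ∃ j t, affineMap^[j] p = (t, 0) ∧ (t, (0 : ℝ)) ∈ horizontalPts := by
  suffices h : ∃ j, (affineMap^[3 * j] p).2 = 0 by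
    obtain ⟨j, hj⟩ := h
    have he : affineMap^[3 * j] p = ((affineMap^[3 * j] p).1, 0) := Prod.ext rfl hj
    exact ⟨3 * j, _, he, he ▸ affineMap_three_mul_mem_horizontalPts hp j⟩
  obtain ⟨b, u⟩ := p
  obtain ⟨⟨l, hl⟩, -⟩ := hp
  simp only at hl
  subst hl
  rcases le_or_gt 0 l with h | h
  · obtain ⟨l, rfl⟩ := Int.eq_ofNat_of_zero_le h
    simpa [flipped_of_even Even.zero] using exists_iterate_flipped_criticalLine _ 0 l b le_rfl
  · obtain ⟨k, hk⟩ := Int.eq_ofNat_of_zero_le (show 0 ≤ -l by omega)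
    obtain rfl : l = -k := by omega
    have := exists_iterate_flipped_criticalLine _ 1 k (1 - b) le_rfl
    rw [flipped_of_odd (by decide), sub_sub_cancel] at this
    simpa using this

/-- The cyclic permutation of the families brings any line to a horizontal one in at most two steps.
The excluded midpoints also lie on the third family, so they are treated as points of that family.
-/
theorem exists_iterate_mem_horizontalPts {p : ℝ × ℝ} (hp : p ∈ affineGrid) :
    ∃ i, affineMap^[i] p ∈ horizontalPts := by
  have step₁ : ∀ b u : ℝ, (∃ k : ℤ, b = k) → (¬ ∃ l : ℤ, u = l) →
      affineMap (b, u) ∈ horizontalPts := by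
    rintro b u ⟨k, rfl⟩ hu
    rcases le_or_gt 0 u with h | h
    · rw [affineMap_of_nonneg h]
      exact ⟨⟨1 - k, by push_cast; ring⟩, fun m hm => hu ⟨m + 1 - k, by
        simp only at hm; push_cast; linarith⟩⟩
    · rw [affineMap_of_neg h]
      exact ⟨⟨-k, by push_cast; ring⟩, fun m hm => hu ⟨m - k, by
        simp only at hm; push_cast; linarith⟩⟩
  have step₂ : ∀ b u : ℝ, (∃ k : ℤ, b + u - 1 / 2 = k) → (¬ ∃ l : ℤ, b = l) →
      affineMap^[2] (b, u) ∈ horizontalPts := by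
    rintro b u ⟨k, hk⟩ hb
    change affineMap (affineMap (b, u)) ∈ _
    rcases le_or_gt 0 u with h | h
    · rw [affineMap_of_nonneg h]
      exact step₁ _ _ ⟨k, hk⟩ fun ⟨m, hm⟩ => hb ⟨1 - m, by push_cast; linarith⟩
    · rw [affineMap_of_neg h]
      exact step₁ _ _ ⟨k + 1, by push_cast; linarith⟩
        fun ⟨m, hm⟩ => hb ⟨-m, by push_cast; linarith⟩
  obtain ⟨b, u⟩ := p
  simp only [affineGrid, Set.mem_ofPred_eq] at hp
  by_cases hu : ∃ l : ℤ, u = l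
  · by_cases hb : ∀ k : ℤ, b ≠ k + 1 / 2
    · exact ⟨0, hu, hb⟩
    · push Not at hb
      obtain ⟨k, rfl⟩ := hb
      obtain ⟨l, rfl⟩ := hu
      refine ⟨2, step₂ _ _ ⟨k + l, by push_cast; ring⟩ ?_⟩
      rintro ⟨m, hm⟩
      have h1 : (m : ℝ) < k + 1 := by linarith
      have h2 : (k : ℝ) < m := by linarith
      norm_cast at h1 h2
      omega
  · by_cases hb : ∃ k : ℤ, b = k
    · exact ⟨1, step₁ _ _ hb hu⟩
    · exact ⟨2, step₂ _ _ ((hp.resolve_left hb).resolve_left hu) hb⟩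

theorem exists_iterate_criticalLine {p : ℝ × ℝ} (hp : p ∈ affineGrid) :
    ∃ j t, affineMap^[j] p = (t, 0) ∧ (t, (0 : ℝ)) ∈ horizontalPts := by
  obtain ⟨i, hi⟩ := exists_iterate_mem_horizontalPts hp
  obtain ⟨j, t, h, ht⟩ := exists_iterate_criticalLine_of_horizontalPts hi
  exact ⟨j + i, t, by rwa [iterate_add_apply], ht⟩

/-- Under an injective map, a point has the same minimal period as its iterates. -/
theorem minimalPeriod_eq_of_iterate {α : Type*} {f : α → α} (hf : Injective f) (n : ℕ) (x : α) :
    minimalPeriod f x = minimalPeriod f (f^[n] x) := by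
  refine minimalPeriod_eq_minimalPeriod_iff.mpr fun k => ?_
  rw [IsPeriodicPt, IsFixedPt, IsPeriodicPt, IsFixedPt, ← iterate_add_apply, add_comm,
    iterate_add_apply]
  exact ((hf.iterate n).eq_iff).symm

theorem minimalPeriod_mem_gridPeriods {p : ℝ × ℝ} (hp : p ∈ affineGrid) :
    minimalPeriod affineMap p ∈ gridPeriods := by
  obtain ⟨j, t, h, ht⟩ := exists_iterate_criticalLine hp
  rw [minimalPeriod_eq_of_iterate affineMap_injective j p, h]
  exact minimalPeriod_mem_gridPeriods_of_criticalLine ht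

theorem criticalSet_eq_grid : criticalSet (Real.pi / 3) = grid := by
  ext p
  obtain ⟨p, rfl⟩ := affineCoord.surjective p
  simp only [criticalSet, Set.mem_iUnion, Set.mem_preimage, F_iterate_affineCoord,
    affineCoord_mem_criticalLine_iff, affineCoord_mem_grid_iff]
  constructor
  · rintro ⟨i, hi⟩
    rw [← affineMap_iterate_mem_affineGrid_iff i]
    exact Or.inr (Or.inl ⟨0, by simpa using hi⟩)
  · intro hp
    obtain ⟨j, t, h, -⟩ := exists_iterate_criticalLine hp
    exact ⟨j, by rw [h]⟩

theorem minimalPeriod_mem_gridPeriods_of_grid {p : ℝ × ℝ} (hp : p ∈ grid) :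
    minimalPeriod (F (Real.pi / 3)) p ∈ gridPeriods := by
  obtain ⟨p, rfl⟩ := affineCoord.surjective p
  rw [minimalPeriod_affineCoord]
  exact minimalPeriod_mem_gridPeriods ((affineCoord_mem_grid_iff p).mp hp)

/-! ### Tiles as triples of integers and the action of the map on them -/

/-- The tile with the indices in the triple `c`. -/
def cellTile (c : ℤ × ℤ × ℤ) : Set (ℝ × ℝ) := tile c.1 c.2.1 c.2.2

/-- The number distinguishing hexagons (`0`) from the two kinds of triangles (`1` and `-1`). -/
def defect (c : ℤ × ℤ × ℤ) : ℤ := c.1 + c.2.1 - c.2.2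

/-- The triples which are the indices of a non-empty tile. -/
def IsCell (c : ℤ × ℤ × ℤ) : Prop := -1 ≤ defect c ∧ defect c ≤ 1

/-- The centre of a tile. -/
noncomputable def cellCenter (c : ℤ × ℤ × ℤ) : ℝ × ℝ :=
  affineCoord (c.1 + 1 / 2 - defect c / 3, c.2.1 + 1 / 2 - defect c / 3)

/-- The action of `F` on the indices of tiles. -/
def cellStep (c : ℤ × ℤ × ℤ) : ℤ × ℤ × ℤ :=
  if 0 ≤ c.2.1 then (c.2.2, -c.1, c.2.1) else (c.2.2 + 1, -c.1 - 1, c.2.1)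

/-- The value of `V` on a tile. -/
def cellLevel (c : ℤ × ℤ × ℤ) : ℤ :=
  max |c.1 - c.2.1 + c.2.2|
    (max (|c.1 + c.2.1 + c.2.2 + 1| - 1) (|-c.1 + c.2.1 + c.2.2 + 1| - 1))

theorem isCell_of_mem {c : ℤ × ℤ × ℤ} {p : ℝ × ℝ} (h : p ∈ cellTile c) : IsCell c := by
  obtain ⟨k, l, m⟩ := c
  obtain ⟨⟨b, u⟩, rfl⟩ := affineCoord.surjective p
  obtain ⟨⟨h1, h2⟩, ⟨h3, h4⟩, ⟨h5, h6⟩⟩ := (affineCoord_mem_tile_iff k l m b u).mp h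
  have h7 : ((m : ℝ)) < k + l + 2 := by linarith
  have h8 : (k + l : ℝ) < m + 2 := by linarith
  norm_cast at h7 h8
  simp only [IsCell, defect]
  omega

theorem cast_defect_cases {c : ℤ × ℤ × ℤ} (h : IsCell c) :
    ((c.1 : ℝ) + c.2.1 - c.2.2 = -1 ∧ (defect c : ℝ) = -1) ∨
      ((c.1 : ℝ) + c.2.1 - c.2.2 = 0 ∧ (defect c : ℝ) = 0) ∨
      ((c.1 : ℝ) + c.2.1 - c.2.2 = 1 ∧ (defect c : ℝ) = 1) := by
  obtain ⟨h1, h2⟩ := h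
  have h3 : (defect c : ℝ) = c.1 + c.2.1 - c.2.2 := by simp [defect]
  rw [← h3]
  have h4 : defect c = -1 ∨ defect c = 0 ∨ defect c = 1 := by omega
  rcases h4 with h | h | h <;> rw [h] <;> norm_num

/-- The correction by a third of the defect is zero for hexagons; for triangles it places the point
at distance `1 / 6` from the three active bounds, measured in `b`, `u` and `b + u - 1 / 2`. -/
theorem cellCenter_mem_cellTile {c : ℤ × ℤ × ℤ} (h : IsCell c) : cellCenter c ∈ cellTile c := by
  obtain ⟨k, l, m⟩ := c
  refine (affineCoord_mem_tile_iff k l m _ _).mpr ?_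
  rcases cast_defect_cases h with ⟨h1, h2⟩ | ⟨h1, h2⟩ | ⟨h1, h2⟩ <;> rw [h2] <;>
    simp only at h1 ⊢ <;> refine ⟨⟨?_, ?_⟩, ⟨?_, ?_⟩, ⟨?_, ?_⟩⟩ <;> linarith

/-- If the sign of `u` agrees with that of the index `l`, the inequalities correspond one to one. If
not, both memberships are impossible, since each forces `l < u < l + 1`. -/
theorem F_mem_cellTile_iff (c : ℤ × ℤ × ℤ) (p : ℝ × ℝ) :
    F (Real.pi / 3) p ∈ cellTile (cellStep c) ↔ p ∈ cellTile c := by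
  obtain ⟨k, l, m⟩ := c
  obtain ⟨⟨b, u⟩, rfl⟩ := affineCoord.surjective p
  rw [F_affineCoord]
  simp only [cellTile, cellStep]
  rcases le_or_gt 0 u with hu | hu
  · rw [affineMap_of_nonneg hu]
    split_ifs with hl
    · rw [affineCoord_mem_tile_iff, affineCoord_mem_tile_iff]
      push_cast
      constructor <;> rintro ⟨⟨h1, h2⟩, ⟨h3, h4⟩, ⟨h5, h6⟩⟩ <;>
        refine ⟨⟨?_, ?_⟩, ⟨?_, ?_⟩, ⟨?_, ?_⟩⟩ <;> linarith
    · have hl' : (l : ℝ) + 1 ≤ 0 := by exact_mod_cast not_le.mp hl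
      rw [affineCoord_mem_tile_iff, affineCoord_mem_tile_iff]
      push_cast
      constructor <;> rintro ⟨⟨h1, h2⟩, ⟨h3, h4⟩, ⟨h5, h6⟩⟩ <;> exfalso <;> linarith
  · rw [affineMap_of_neg hu]
    split_ifs with hl
    · have hl' : (0 : ℝ) ≤ l := by exact_mod_cast hl
      rw [affineCoord_mem_tile_iff, affineCoord_mem_tile_iff]
      push_cast
      constructor <;> rintro ⟨⟨h1, h2⟩, ⟨h3, h4⟩, ⟨h5, h6⟩⟩ <;> exfalso <;> linarith
    · rw [affineCoord_mem_tile_iff, affineCoord_mem_tile_iff]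
      push_cast
      constructor <;> rintro ⟨⟨h1, h2⟩, ⟨h3, h4⟩, ⟨h5, h6⟩⟩ <;>
        refine ⟨⟨?_, ?_⟩, ⟨?_, ?_⟩, ⟨?_, ?_⟩⟩ <;> linarith

theorem F_image_cellTile (c : ℤ × ℤ × ℤ) :
    F (Real.pi / 3) '' cellTile c = cellTile (cellStep c) := by
  ext q
  obtain ⟨p, rfl⟩ := F_bijective.surjective q
  rw [F_bijective.injective.mem_set_image, F_mem_cellTile_iff]

theorem F_cellCenter {c : ℤ × ℤ × ℤ} (h : IsCell c) :
    F (Real.pi / 3) (cellCenter c) = cellCenter (cellStep c) := by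
  obtain ⟨k, l, m⟩ := c
  rw [cellCenter, F_affineCoord, cellCenter]
  congr 1
  have hd := cast_defect_cases h
  simp only [cellStep] at hd ⊢
  split_ifs with hl
  · have hl' : (0 : ℝ) ≤ l := by exact_mod_cast hl
    have hu : (0 : ℝ) ≤ l + 1 / 2 - (defect (k, l, m) : ℝ) / 3 := by
      rcases hd with ⟨-, h2⟩ | ⟨-, h2⟩ | ⟨-, h2⟩ <;> rw [h2] <;> linarith
    rw [affineMap_of_nonneg hu]
    simp only [defect]
    ext <;> push_cast <;> ring
  · have hl' : (l : ℝ) + 1 ≤ 0 := by exact_mod_cast not_le.mp hl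
    have hu : l + 1 / 2 - (defect (k, l, m) : ℝ) / 3 < 0 := by
      rcases hd with ⟨-, h2⟩ | ⟨-, h2⟩ | ⟨-, h2⟩ <;> rw [h2] <;> linarith
    rw [affineMap_of_neg hu]
    simp only [defect]
    ext <;> push_cast <;> ring

theorem indices_of_mem_cellTile {c : ℤ × ℤ × ℤ} {p : ℝ × ℝ} (h : p ∈ cellTile c) :
    (B p, C p, D p) = c := by
  obtain ⟨k, l, m⟩ := c
  obtain ⟨⟨b, u⟩, rfl⟩ := affineCoord.surjective p
  obtain ⟨⟨h1, h2⟩, ⟨h3, h4⟩, ⟨h5, h6⟩⟩ := (affineCoord_mem_tile_iff k l m b u).mp h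
  rw [B_affineCoord, C_affineCoord, D_affineCoord, Int.floor_eq_iff.mpr ⟨h1.le, h2⟩,
    Int.floor_eq_iff.mpr ⟨h3.le, h4⟩, Int.floor_eq_iff.mpr ⟨h5.le, h6⟩]

theorem disjoint_cellTile {c c' : ℤ × ℤ × ℤ} (h : c ≠ c') :
    Disjoint (cellTile c) (cellTile c') :=
  Set.disjoint_left.mpr fun _ hp hp' =>
    h ((indices_of_mem_cellTile hp).symm.trans (indices_of_mem_cellTile hp'))

theorem V_of_mem_cellTile {c : ℤ × ℤ × ℤ} {p : ℝ × ℝ} (h : p ∈ cellTile c) :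
    V p = cellLevel c := by
  rw [← indices_of_mem_cellTile h, cellLevel, V]

theorem notMem_grid_of_mem_cellTile {c : ℤ × ℤ × ℤ} {p : ℝ × ℝ} (h : p ∈ cellTile c) :
    p ∉ grid := by
  obtain ⟨k, l, m⟩ := c
  obtain ⟨⟨b, u⟩, rfl⟩ := affineCoord.surjective p
  obtain ⟨⟨h1, h2⟩, ⟨h3, h4⟩, ⟨h5, h6⟩⟩ := (affineCoord_mem_tile_iff k l m b u).mp h
  have key : ∀ (x : ℝ) (a z : ℤ), (a : ℝ) < x → x < a + 1 → x ≠ z := by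
    rintro x a z h h' rfl
    norm_cast at h h'
    omega
  rw [affineCoord_mem_grid_iff]
  rintro (⟨z, hz⟩ | ⟨z, hz⟩ | ⟨z, hz⟩)
  · exact key _ _ _ h1 h2 hz
  · exact key _ _ _ h3 h4 hz
  · exact key _ _ _ h5 h6 hz

theorem mem_cellTile_of_notMem_grid {p : ℝ × ℝ} (h : p ∉ grid) :
    p ∈ cellTile (B p, C p, D p) := by
  obtain ⟨⟨b, u⟩, rfl⟩ := affineCoord.surjective p
  rw [affineCoord_mem_grid_iff] at h
  simp only [affineGrid, Set.mem_ofPred_eq, not_or, not_exists] at h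
  rw [B_affineCoord, C_affineCoord, D_affineCoord]
  have key : ∀ x : ℝ, (∀ z : ℤ, x ≠ z) → (⌊x⌋ : ℝ) < x ∧ x < ⌊x⌋ + 1 := fun x hx =>
    ⟨lt_of_le_of_ne (Int.floor_le x) (hx _).symm, Int.lt_floor_add_one x⟩
  exact (affineCoord_mem_tile_iff _ _ _ b u).mpr ⟨key _ h.1, key _ h.2.1, key _ h.2.2⟩

/-- A point satisfying the weak inequalities of a tile lies in its closure. -/
theorem mem_closure_cellTile {c : ℤ × ℤ × ℤ} (hc : IsCell c) {b u : ℝ}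
    (h₁ : (c.1 : ℝ) ≤ b) (h₂ : b ≤ c.1 + 1) (h₃ : (c.2.1 : ℝ) ≤ u) (h₄ : u ≤ c.2.1 + 1)
    (h₅ : (c.2.2 : ℝ) ≤ b + u - 1 / 2) (h₆ : b + u - 1 / 2 ≤ c.2.2 + 1) :
    affineCoord (b, u) ∈ closure (cellTile c) := by
  obtain ⟨k, l, m⟩ := c
  have hX := cellCenter_mem_cellTile hc
  rw [cellCenter] at hX
  generalize ((k, l, m) : ℤ × ℤ × ℤ).1 + 1 / 2 - (defect (k, l, m) : ℝ) / 3 = b' at hX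
  generalize (((k, l, m) : ℤ × ℤ × ℤ).2.1 : ℝ) + 1 / 2 - (defect (k, l, m) : ℝ) / 3 = u' at hX
  obtain ⟨⟨g1, g2⟩, ⟨g3, g4⟩, ⟨g5, g6⟩⟩ := (affineCoord_mem_tile_iff k l m b' u').mp hX
  simp only at h₁ h₂ h₃ h₄ h₅ h₆
  -- Slide the point towards the centre: by convexity, all inequalities become strict for `0 < t <
  -- 1`.
  have hcont : Continuous fun t : ℝ => affineCoord (b + t * (b' - b), u + t * (u' - u)) := by
    simp only [affineCoord_apply]
    fun_prop
  have hlim := (hcont.tendsto 0).mono_left (nhdsWithin_le_nhds (s := Set.Ioi 0))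
  simp only [zero_mul, add_zero] at hlim
  refine mem_closure_of_tendsto hlim ?_
  filter_upwards [Ioo_mem_nhdsGT (show (0 : ℝ) < 1 by norm_num)] with t ht
  obtain ⟨t0, t1⟩ := ht
  have s0 : 0 < 1 - t := by linarith
  refine (affineCoord_mem_tile_iff k l m _ _).mpr ⟨⟨?_, ?_⟩, ⟨?_, ?_⟩, ⟨?_, ?_⟩⟩
  · linarith [mul_pos t0 (sub_pos.mpr g1), mul_nonneg s0.le (sub_nonneg.mpr h₁)]
  · linarith [mul_pos t0 (sub_pos.mpr g2), mul_nonneg s0.le (sub_nonneg.mpr h₂)]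
  · linarith [mul_pos t0 (sub_pos.mpr g3), mul_nonneg s0.le (sub_nonneg.mpr h₃)]
  · linarith [mul_pos t0 (sub_pos.mpr g4), mul_nonneg s0.le (sub_nonneg.mpr h₄)]
  · linarith [mul_pos t0 (sub_pos.mpr g5), mul_nonneg s0.le (sub_nonneg.mpr h₅)]
  · linarith [mul_pos t0 (sub_pos.mpr g6), mul_nonneg s0.le (sub_nonneg.mpr h₆)]

/-! ### Tiles are regular polygons -/

theorem cellCenter_sub (c : ℤ × ℤ × ℤ) (b u : ℝ) :
    (affineCoord (b, u)).1 - (cellCenter c).1 =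
        2 * (b - (c.1 + 1 / 2 - defect c / 3)) + (u - (c.2.1 + 1 / 2 - defect c / 3)) ∧
      (affineCoord (b, u)).2 - (cellCenter c).2 =
        √3 * (u - (c.2.1 + 1 / 2 - defect c / 3)) := by
  simp only [cellCenter, affineCoord_apply]
  constructor <;> ring

theorem sqrt_three_mul_lt_iff {L x r : ℝ} (h : L = √3 * x) : L < √3 * r ↔ x < r := by
  rw [h, mul_lt_mul_iff_right₀ sqrt_three_pos]

/-- Relative to the centre the tile is `|β|, |μ|, |β + μ| < 1 / 2`; the six normals are the two
opposite normals of each family of lines. -/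
theorem isOpenRegularPolygon_hexagon {c : ℤ × ℤ × ℤ} (hc : defect c = 0) :
    IsOpenRegularPolygon 6 (cellTile c) (cellCenter c) := by
  refine ⟨by norm_num, √3 * (1 / 2), by positivity, Real.pi / 6, ?_⟩
  ext p
  obtain ⟨⟨b, u⟩, rfl⟩ := affineCoord.surjective p
  obtain ⟨hx, hy⟩ := cellCenter_sub c b u
  have hd : (c.1 : ℝ) + c.2.1 - c.2.2 = 0 := by
    rw [defect] at hc; exact_mod_cast hc
  generalize hβ : b - ((c.1 : ℝ) + 1 / 2 - defect c / 3) = β at hx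
  generalize hμ : u - ((c.2.1 : ℝ) + 1 / 2 - defect c / 3) = μ at hx hy
  rw [hc] at hβ hμ
  push_cast at hβ hμ
  simp only [Set.mem_ofPred_eq, hx, hy]
  have a0 : Real.pi / 6 + 2 * Real.pi * ((0 : ℕ) : ℝ) / (6 : ℕ) = Real.pi / 6 := by
    push_cast; ring
  have a1 : Real.pi / 6 + 2 * Real.pi * ((1 : ℕ) : ℝ) / (6 : ℕ) = Real.pi / 2 := by
    push_cast; ring
  have a2 : Real.pi / 6 + 2 * Real.pi * ((2 : ℕ) : ℝ) / (6 : ℕ) = Real.pi - Real.pi / 6 := by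
    push_cast; ring
  have a3 : Real.pi / 6 + 2 * Real.pi * ((3 : ℕ) : ℝ) / (6 : ℕ) = Real.pi / 6 + Real.pi := by
    push_cast; ring
  have a4 : Real.pi / 6 + 2 * Real.pi * ((4 : ℕ) : ℝ) / (6 : ℕ) = Real.pi / 2 + Real.pi := by
    push_cast; ring
  have a5 : Real.pi / 6 + 2 * Real.pi * ((5 : ℕ) : ℝ) / (6 : ℕ) = 2 * Real.pi - Real.pi / 6 := by
    push_cast; ring
  have all : ∀ P : ℕ → Prop, (∀ j < 6, P j) ↔ P 0 ∧ P 1 ∧ P 2 ∧ P 3 ∧ P 4 ∧ P 5 := fun P =>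
    ⟨fun h => ⟨h 0 (by norm_num), h 1 (by norm_num), h 2 (by norm_num), h 3 (by norm_num),
      h 4 (by norm_num), h 5 (by norm_num)⟩, fun h j hj => by
        obtain ⟨h0, h1, h2, h3, h4, h5⟩ := h
        interval_cases j <;> assumption⟩
  rw [all, a0, a1, a2, a3, a4, a5]
  simp only [Real.cos_two_pi_sub, Real.sin_two_pi_sub, Real.cos_pi_sub, Real.sin_pi_sub,
    Real.cos_add_pi, Real.sin_add_pi, Real.cos_pi_div_six, Real.sin_pi_div_six,
    Real.cos_pi_div_two, Real.sin_pi_div_two]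
  refine (affineCoord_mem_tile_iff _ _ _ b u).trans (Iff.trans ?_ (and_congr
    (sqrt_three_mul_lt_iff (x := β + μ) (by ring)) (and_congr
    (sqrt_three_mul_lt_iff (x := μ) (by ring)) (and_congr
    (sqrt_three_mul_lt_iff (x := -β) (by ring)) (and_congr
    (sqrt_three_mul_lt_iff (x := -(β + μ)) (by ring)) (and_congr
    (sqrt_three_mul_lt_iff (x := -μ) (by ring))
    (sqrt_three_mul_lt_iff (x := β) (by ring))))))).symm)
  constructor
  · rintro ⟨⟨h1, h2⟩, ⟨h3, h4⟩, ⟨h5, h6⟩⟩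
    refine ⟨?_, ?_, ?_, ?_, ?_, ?_⟩ <;> linarith
  · rintro ⟨h1, h2, h3, h4, h5, h6⟩
    refine ⟨⟨?_, ?_⟩, ⟨?_, ?_⟩, ⟨?_, ?_⟩⟩ <;> linarith

/-- Only three of the six tile inequalities are active, each at offset `1 / 6` from the centre, and
they imply the others. The sign of the defect selects which three, hence the initial angle. -/
theorem isOpenRegularPolygon_triangle {c : ℤ × ℤ × ℤ} (hc : defect c = 1 ∨ defect c = -1) :
    IsOpenRegularPolygon 3 (cellTile c) (cellCenter c) := by
  have all : ∀ P : ℕ → Prop, (∀ j < 3, P j) ↔ P 0 ∧ P 1 ∧ P 2 := fun P =>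
    ⟨fun h => ⟨h 0 (by norm_num), h 1 (by norm_num), h 2 (by norm_num)⟩, fun h j hj => by
        obtain ⟨h0, h1, h2⟩ := h
        interval_cases j <;> assumption⟩
  rcases hc with hc | hc
  · refine ⟨by norm_num, √3 * (1 / 6), by positivity, Real.pi / 6, ?_⟩
    ext p
    obtain ⟨⟨b, u⟩, rfl⟩ := affineCoord.surjective p
    obtain ⟨hx, hy⟩ := cellCenter_sub c b u
    have hd : (c.1 : ℝ) + c.2.1 - c.2.2 = 1 := by
      rw [defect] at hc; exact_mod_cast hc
    generalize hβ : b - ((c.1 : ℝ) + 1 / 2 - defect c / 3) = β at hx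
    generalize hμ : u - ((c.2.1 : ℝ) + 1 / 2 - defect c / 3) = μ at hx hy
    rw [hc] at hβ hμ
    push_cast at hβ hμ
    simp only [Set.mem_ofPred_eq, hx, hy]
    have a0 : Real.pi / 6 + 2 * Real.pi * ((0 : ℕ) : ℝ) / (3 : ℕ) = Real.pi / 6 := by
      push_cast; ring
    have a1 : Real.pi / 6 + 2 * Real.pi * ((1 : ℕ) : ℝ) / (3 : ℕ) = Real.pi - Real.pi / 6 := by
      push_cast; ring
    have a2 : Real.pi / 6 + 2 * Real.pi * ((2 : ℕ) : ℝ) / (3 : ℕ) = Real.pi / 2 + Real.pi := by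
      push_cast; ring
    rw [all, a0, a1, a2]
    simp only [Real.cos_pi_sub, Real.sin_pi_sub, Real.cos_add_pi, Real.sin_add_pi,
      Real.cos_pi_div_six, Real.sin_pi_div_six, Real.cos_pi_div_two, Real.sin_pi_div_two]
    refine (affineCoord_mem_tile_iff _ _ _ b u).trans (Iff.trans ?_ (and_congr
      (sqrt_three_mul_lt_iff (x := β + μ) (by ring)) (and_congr
      (sqrt_three_mul_lt_iff (x := -β) (by ring))
      (sqrt_three_mul_lt_iff (x := -μ) (by ring)))).symm)
    constructor
    · rintro ⟨⟨h1, h2⟩, ⟨h3, h4⟩, ⟨h5, h6⟩⟩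
      refine ⟨?_, ?_, ?_⟩ <;> linarith
    · rintro ⟨h1, h2, h3⟩
      refine ⟨⟨?_, ?_⟩, ⟨?_, ?_⟩, ⟨?_, ?_⟩⟩ <;> linarith
  · refine ⟨by norm_num, √3 * (1 / 6), by positivity, -(Real.pi / 6), ?_⟩
    ext p
    obtain ⟨⟨b, u⟩, rfl⟩ := affineCoord.surjective p
    obtain ⟨hx, hy⟩ := cellCenter_sub c b u
    have hd : (c.1 : ℝ) + c.2.1 - c.2.2 = -1 := by
      rw [defect] at hc; exact_mod_cast hc
    generalize hβ : b - ((c.1 : ℝ) + 1 / 2 - defect c / 3) = β at hx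
    generalize hμ : u - ((c.2.1 : ℝ) + 1 / 2 - defect c / 3) = μ at hx hy
    rw [hc] at hβ hμ
    push_cast at hβ hμ
    simp only [Set.mem_ofPred_eq, hx, hy]
    have a0 : -(Real.pi / 6) + 2 * Real.pi * ((0 : ℕ) : ℝ) / (3 : ℕ) = -(Real.pi / 6) := by
      push_cast; ring
    have a1 : -(Real.pi / 6) + 2 * Real.pi * ((1 : ℕ) : ℝ) / (3 : ℕ) = Real.pi / 2 := by
      push_cast; ring
    have a2 : -(Real.pi / 6) + 2 * Real.pi * ((2 : ℕ) : ℝ) / (3 : ℕ) = Real.pi / 6 + Real.pi := by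
      push_cast; ring
    rw [all, a0, a1, a2]
    simp only [Real.cos_neg, Real.sin_neg, Real.cos_add_pi, Real.sin_add_pi,
      Real.cos_pi_div_six, Real.sin_pi_div_six, Real.cos_pi_div_two, Real.sin_pi_div_two]
    refine (affineCoord_mem_tile_iff _ _ _ b u).trans (Iff.trans ?_ (and_congr
      (sqrt_three_mul_lt_iff (x := β) (by ring)) (and_congr
      (sqrt_three_mul_lt_iff (x := μ) (by ring))
      (sqrt_three_mul_lt_iff (x := -(β + μ)) (by ring)))).symm)
    constructor
    · rintro ⟨⟨h1, h2⟩, ⟨h3, h4⟩, ⟨h5, h6⟩⟩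
      refine ⟨?_, ?_, ?_⟩ <;> linarith
    · rintro ⟨h1, h2, h3⟩
      refine ⟨⟨?_, ?_⟩, ⟨?_, ?_⟩, ⟨?_, ?_⟩⟩ <;> linarith

/-! ### The map is a rotation on each tile -/

/-- The image of `p` under the rotation of angle `θ` followed by the translation which together
map `X` to `Y`. -/
noncomputable def rotateTo (θ : ℝ) (X Y p : ℝ × ℝ) : ℝ × ℝ :=
  (Y.1 + (Real.cos θ * (p.1 - X.1) - Real.sin θ * (p.2 - X.2)),
    Y.2 + (Real.sin θ * (p.1 - X.1) + Real.cos θ * (p.2 - X.2)))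

theorem rotateTo_rotateTo (θ θ' : ℝ) (X Y Z p : ℝ × ℝ) :
    rotateTo θ' Y Z (rotateTo θ X Y p) = rotateTo (θ' + θ) X Z p := by
  simp only [rotateTo, Real.cos_add, Real.sin_add]
  ext <;> simp only <;> ring

theorem eq_of_rotateTo_eq_self {θ : ℝ} {X p : ℝ × ℝ} (h : rotateTo θ X X p = p) (hp : p ≠ X) :
    Real.cos θ = 1 := by
  have h1 := congrArg Prod.fst h
  have h2 := congrArg Prod.snd h
  simp only [rotateTo] at h1 h2
  -- The inner product of `R v - v` with `v` is `(cos θ - 1) * |v| ^ 2`, where `v = p - X`.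
  have h3 : (Real.cos θ - 1) * ((p.1 - X.1) ^ 2 + (p.2 - X.2) ^ 2) = 0 := by
    linear_combination (p.1 - X.1) * h1 + (p.2 - X.2) * h2
  rcases mul_eq_zero.mp h3 with h | h
  · linarith
  · exfalso
    apply hp
    ext <;> nlinarith [sq_nonneg (p.1 - X.1), sq_nonneg (p.2 - X.2)]

theorem sgn_eq_of_mem_cellTile {c : ℤ × ℤ × ℤ} {p q : ℝ × ℝ} (hp : p ∈ cellTile c)
    (hq : q ∈ cellTile c) : sgn p.2 = sgn q.2 := by
  obtain ⟨k, l, m⟩ := c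
  obtain ⟨-, ⟨h1, h2⟩, -⟩ := hp
  obtain ⟨-, ⟨h3, h4⟩, -⟩ := hq
  have hpos := sqrt_three_pos
  simp only at h1 h2 h3 h4
  rcases le_or_gt 0 l with h | h
  · have h' : (0 : ℝ) ≤ √3 * l := mul_nonneg hpos.le (by exact_mod_cast h)
    rw [sgn, if_pos (by linarith), sgn, if_pos (by linarith)]
  · have h' : √3 * ((l : ℝ) + 1) ≤ 0 :=
      mul_nonpos_of_nonneg_of_nonpos hpos.le (by exact_mod_cast h)
    rw [sgn, if_neg (by linarith), sgn, if_neg (by linarith)]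

theorem F_of_mem_cellTile {c : ℤ × ℤ × ℤ} {p : ℝ × ℝ} (hp : p ∈ cellTile c) :
    F (Real.pi / 3) p =
      rotateTo (-(Real.pi / 3)) (cellCenter c) (cellCenter (cellStep c)) p := by
  have hc := isCell_of_mem hp
  rw [← F_cellCenter hc]
  have hs := sgn_eq_of_mem_cellTile hp (cellCenter_mem_cellTile hc)
  simp only [F, rotateTo, Real.cos_neg, Real.sin_neg, hs]
  ext <;> simp only <;> ring

theorem addOrderOf_natCast_mul_neg_pi_div_three (n : ℕ) :
    addOrderOf (((n : ℝ) * (-(Real.pi / 3)) : ℝ) : Real.Angle) = 6 / Nat.gcd 6 n := by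
  have : Fact (0 < 2 * Real.pi) := ⟨Real.two_pi_pos⟩
  have h : addOrderOf ((Real.pi / 3 : ℝ) : Real.Angle) = 6 := by
    have h := AddCircle.addOrderOf_period_div (p := 2 * Real.pi) (n := 6) (by norm_num)
    rw [show 2 * Real.pi / ((6 : ℕ) : ℝ) = Real.pi / 3 by push_cast; ring] at h
    exact h
  have hpos : 0 < addOrderOf (-((Real.pi / 3 : ℝ) : Real.Angle)) := by
    rw [addOrderOf_neg, h]; norm_num
  rw [Real.Angle.natCast_mul_eq_nsmul, Real.Angle.coe_neg,
    (addOrderOf_pos_iff.mp hpos).addOrderOf_nsmul, addOrderOf_neg, h]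

theorem six_dvd_of_cos_eq_one {n : ℕ} (h : Real.cos ((n : ℝ) * (-(Real.pi / 3))) = 1) :
    6 ∣ n := by
  obtain ⟨k, hk⟩ := (Real.cos_eq_one_iff _).mp h
  have h1 : (n : ℝ) = -6 * k := by
    have := Real.pi_pos
    field_simp at hk
    linarith
  have h2 : (n : ℤ) = -6 * k := by exact_mod_cast h1
  omega

/-! ### Clockwise order and contact of tiles -/

theorem arg_lt_arg_of_im_neg {z w : ℂ} (hz : 0 ≤ z.im) (hw : w.im < 0) :
    Complex.arg w < Complex.arg z :=
  (Complex.arg_neg_iff.mpr hw).trans_le (Complex.arg_nonneg_iff.mpr hz)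

/-- Within one open half-plane the difference of arguments stays in `(-π, π)`, where its sign is
that of its sine, that is, of the cross product. -/
theorem arg_lt_arg_of_cross_pos {z w : ℂ} (h : (0 < z.im ∧ 0 < w.im) ∨ (z.im < 0 ∧ w.im < 0))
    (hc : 0 < w.re * z.im - w.im * z.re) : Complex.arg w < Complex.arg z := by
  have hz : z ≠ 0 := by
    rintro rfl
    simp at h
  have hw : w ≠ 0 := by
    rintro rfl
    simp at h
  have hz' := norm_pos_iff.mpr hz
  have hw' := norm_pos_iff.mpr hw
  have hsin : 0 < Real.sin (Complex.arg z - Complex.arg w) := by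
    rw [Real.sin_sub, Complex.sin_arg, Complex.sin_arg, Complex.cos_arg hz, Complex.cos_arg hw]
    have : z.im / ‖z‖ * (w.re / ‖w‖) - z.re / ‖z‖ * (w.im / ‖w‖) =
        (w.re * z.im - w.im * z.re) / (‖z‖ * ‖w‖) := by
      field_simp
    rw [this]
    positivity
  by_contra! hle
  have hgt : -Real.pi < Complex.arg z - Complex.arg w := by
    rcases h with ⟨h1, h2⟩ | ⟨h1, h2⟩
    · linarith [Complex.arg_nonneg_iff.mpr h1.le, Complex.arg_lt_pi_iff.mpr (Or.inr h2.ne')]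
    · linarith [Complex.neg_pi_lt_arg z, Complex.arg_neg_iff.mpr h2]
  exact absurd hsin (not_lt.mpr (Real.sin_nonpos_of_nonpos_of_neg_pi_le (by linarith) hgt.le))

/-- Two tiles whose centres are in clockwise order around the origin, before the negative
horizontal axis is reached. -/
def ClockwiseCells (c c' : ℤ × ℤ × ℤ) : Prop :=
  (0 ≤ c.2.1 ∧ c'.2.1 < 0) ∨ ((0 ≤ c.2.1 ↔ 0 ≤ c'.2.1) ∧
    0 < (3 * c'.1 - defect c') * (6 * c.2.1 + 3 - 2 * defect c) -
      (6 * c'.2.1 + 3 - 2 * defect c') * (3 * c.1 - defect c))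

theorem cellCenter_snd (c : ℤ × ℤ × ℤ) :
    (cellCenter c).2 = √3 / 6 * ((6 * c.2.1 + 3 - 2 * defect c : ℤ) : ℝ) := by
  simp only [cellCenter, affineCoord_apply]
  push_cast
  ring

theorem cellCenter_snd_pos {c : ℤ × ℤ × ℤ} (hc : IsCell c) (h : 0 ≤ c.2.1) :
    0 < (cellCenter c).2 := by
  rw [cellCenter_snd]
  have : 0 < 6 * c.2.1 + 3 - 2 * defect c := by
    have := hc.2
    omega
  have : (0 : ℝ) < ((6 * c.2.1 + 3 - 2 * defect c : ℤ) : ℝ) := by exact_mod_cast this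
  positivity

theorem cellCenter_snd_neg {c : ℤ × ℤ × ℤ} (hc : IsCell c) (h : c.2.1 < 0) :
    (cellCenter c).2 < 0 := by
  rw [cellCenter_snd]
  have : 6 * c.2.1 + 3 - 2 * defect c < 0 := by
    have := hc.1
    omega
  have : ((6 * c.2.1 + 3 - 2 * defect c : ℤ) : ℝ) < 0 := by exact_mod_cast this
  exact mul_neg_of_pos_of_neg (by positivity) this

/-- The summand `u` in `2 * b + u - 1` is proportional to the second coordinate and cancels in the
cross product. What remains is integral up to the factor `√3 / 9`. -/
theorem ClockwiseCells.arg_lt {c c' : ℤ × ℤ × ℤ} (h : ClockwiseCells c c') (hc : IsCell c)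
    (hc' : IsCell c') : Complex.arg ⟨(cellCenter c').1, (cellCenter c').2⟩ <
      Complex.arg ⟨(cellCenter c).1, (cellCenter c).2⟩ := by
  rcases h with ⟨h, h'⟩ | ⟨h, h'⟩
  · exact arg_lt_arg_of_im_neg (cellCenter_snd_pos hc h).le (cellCenter_snd_neg hc' h')
  · refine arg_lt_arg_of_cross_pos ?_ ?_
    · rcases le_or_gt 0 c.2.1 with h1 | h1
      · exact Or.inl ⟨cellCenter_snd_pos hc h1, cellCenter_snd_pos hc' (h.mp h1)⟩
      · exact Or.inr ⟨cellCenter_snd_neg hc h1, cellCenter_snd_neg hc' (by omega)⟩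
    · have h1 : (0 : ℝ) < (((3 * c'.1 - defect c') * (6 * c.2.1 + 3 - 2 * defect c) -
          (6 * c'.2.1 + 3 - 2 * defect c') * (3 * c.1 - defect c) : ℤ) : ℝ) := by
        exact_mod_cast h'
      have h2 : (cellCenter c').1 * (cellCenter c).2 - (cellCenter c').2 * (cellCenter c).1 =
          √3 / 9 * (((3 * c'.1 - defect c') * (6 * c.2.1 + 3 - 2 * defect c) -
          (6 * c'.2.1 + 3 - 2 * defect c') * (3 * c.1 - defect c) : ℤ) : ℝ) := by
        simp only [cellCenter, affineCoord_apply]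
        push_cast
        ring
      simp only [h2]
      positivity

/-- Two tiles whose closures meet. -/
def TouchingCells (c c' : ℤ × ℤ × ℤ) : Prop :=
  (closure (cellTile c) ∩ closure (cellTile c')).Nonempty

theorem TouchingCells.symm {c c' : ℤ × ℤ × ℤ} (h : TouchingCells c c') : TouchingCells c' c := by
  rwa [TouchingCells, Set.inter_comm]

/-- Neighbouring hexagons of the trihexagonal grid share only a vertex; each witness is that vertex.
-/
theorem touchingCells_hexagon {c c' : ℤ × ℤ × ℤ} (hc : defect c = 0) (hc' : defect c' = 0)
    (h : (c'.1 = c.1 ∧ c'.2.1 = c.2.1 + 1) ∨ (c'.1 = c.1 + 1 ∧ c'.2.1 = c.2.1) ∨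
      (c'.1 = c.1 + 1 ∧ c'.2.1 = c.2.1 - 1)) : TouchingCells c c' := by
  have hi : IsCell c := ⟨by omega, by omega⟩
  have hi' : IsCell c' := ⟨by omega, by omega⟩
  obtain ⟨k, l, m⟩ := c
  obtain ⟨k', l', m'⟩ := c'
  simp only [defect] at hc hc' h
  rcases h with ⟨rfl, rfl⟩ | ⟨rfl, rfl⟩ | ⟨rfl, rfl⟩
  · refine ⟨affineCoord (k' + 1 / 2, l + 1), mem_closure_cellTile hi ?_ ?_ ?_ ?_ ?_ ?_,
      mem_closure_cellTile hi' ?_ ?_ ?_ ?_ ?_ ?_⟩ <;>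
      simp only [show m = k' + l by omega, show m' = k' + l + 1 by omega] <;> push_cast <;> linarith
  · refine ⟨affineCoord (k + 1, l' + 1 / 2), mem_closure_cellTile hi ?_ ?_ ?_ ?_ ?_ ?_,
      mem_closure_cellTile hi' ?_ ?_ ?_ ?_ ?_ ?_⟩ <;>
      simp only [show m = k + l' by omega, show m' = k + l' + 1 by omega] <;> push_cast <;> linarith
  · refine ⟨affineCoord (k + 1, l), mem_closure_cellTile hi ?_ ?_ ?_ ?_ ?_ ?_,
      mem_closure_cellTile hi' ?_ ?_ ?_ ?_ ?_ ?_⟩ <;>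
      simp only [show m = k + l by omega, show m' = k + l by omega] <;> push_cast <;> linarith

theorem touchingCells_triangle {c c' : ℤ × ℤ × ℤ} (hc : defect c = 1) (hc' : defect c' = -1)
    (h : (c'.1 = c.1 - 1 ∧ c'.2.1 = c.2.1) ∨ (c'.1 = c.1 ∧ c'.2.1 = c.2.1 - 1) ∨
      (c'.1 = c.1 - 1 ∧ c'.2.1 = c.2.1 - 1)) : TouchingCells c c' := by
  have hi : IsCell c := ⟨by omega, by omega⟩
  have hi' : IsCell c' := ⟨by omega, by omega⟩
  obtain ⟨k, l, m⟩ := c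
  obtain ⟨k', l', m'⟩ := c'
  simp only [defect] at hc hc' h
  rcases h with ⟨rfl, rfl⟩ | ⟨rfl, rfl⟩ | ⟨rfl, rfl⟩
  · refine ⟨affineCoord (k, l' + 1 / 2), mem_closure_cellTile hi ?_ ?_ ?_ ?_ ?_ ?_,
      mem_closure_cellTile hi' ?_ ?_ ?_ ?_ ?_ ?_⟩ <;>
      simp only [show m = k + l' - 1 by omega, show m' = k + l' by omega] <;> push_cast <;> linarith
  · refine ⟨affineCoord (k' + 1 / 2, l), mem_closure_cellTile hi ?_ ?_ ?_ ?_ ?_ ?_,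
      mem_closure_cellTile hi' ?_ ?_ ?_ ?_ ?_ ?_⟩ <;>
      simp only [show m = k' + l - 1 by omega, show m' = k' + l by omega] <;> push_cast <;> linarith
  · refine ⟨affineCoord (k, l), mem_closure_cellTile hi ?_ ?_ ?_ ?_ ?_ ?_,
      mem_closure_cellTile hi' ?_ ?_ ?_ ?_ ?_ ?_⟩ <;>
      simp only [show m = k + l - 1 by omega, show m' = k + l - 1 by omega] <;> push_cast <;>
      linarith

/-! ### Cycles of tiles: iterates, periods and necklaces -/

/-- A cyclic enumeration `κ` of `M` tiles which is shifted by `u` under the action of `F`. -/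
structure IsCellCycle (M u : ℕ) (κ : ℕ → ℤ × ℤ × ℤ) : Prop where
  isCell : ∀ i < M, IsCell (κ i)
  inj : ∀ i < M, ∀ j < M, κ i = κ j → i = j
  step : ∀ i < M, κ ((i + u) % M) = cellStep (κ i)

/-- The tiles of an enumeration, labelled by `ZMod M`. -/
def cycleTile (M : ℕ) (κ : ℕ → ℤ × ℤ × ℤ) (i : ZMod M) : Set (ℝ × ℝ) := cellTile (κ i.val)

/-- The centres of the tiles of an enumeration, labelled by `ZMod M`. -/
noncomputable def cycleCenter (M : ℕ) (κ : ℕ → ℤ × ℤ × ℤ) (i : ZMod M) : ℝ × ℝ :=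
  cellCenter (κ i.val)

section Cycle

variable {M u : ℕ} [NeZero M] {κ : ℕ → ℤ × ℤ × ℤ}

theorem IsCellCycle.cell_add (h : IsCellCycle M u κ) (i : ZMod M) :
    κ (i + (u : ZMod M)).val = cellStep (κ i.val) := by
  rw [← h.step _ (ZMod.val_lt i), ZMod.val_add, ZMod.val_natCast, Nat.add_mod_mod]

theorem IsCellCycle.actsAsShift (h : IsCellCycle M u κ) :
    ActsAsShift (F (Real.pi / 3)) (cycleTile M κ) (cycleCenter M κ) u := by
  intro i
  simp only [cycleTile, cycleCenter]
  rw [h.cell_add, F_image_cellTile, F_cellCenter (h.isCell _ (ZMod.val_lt i))]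
  exact ⟨rfl, rfl⟩

theorem IsCellCycle.disjoint (h : IsCellCycle M u κ) {i j : ZMod M} (hij : i ≠ j) :
    Disjoint (cycleTile M κ i) (cycleTile M κ j) :=
  disjoint_cellTile fun he => hij (ZMod.val_injective M
    (h.inj _ (ZMod.val_lt i) _ (ZMod.val_lt j) he))

theorem IsCellCycle.center_mem (h : IsCellCycle M u κ) (i : ZMod M) :
    cycleCenter M κ i ∈ cycleTile M κ i :=
  cellCenter_mem_cellTile (h.isCell _ (ZMod.val_lt i))

theorem IsCellCycle.iterate_image (h : IsCellCycle M u κ) (n : ℕ) (i : ZMod M) :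
    (F (Real.pi / 3))^[n] '' cycleTile M κ i = cycleTile M κ (i + ((n * u : ℕ) : ZMod M)) := by
  induction n with
  | zero => simp
  | succ n ih =>
    rw [iterate_succ', Set.image_comp, ih, (h.actsAsShift _).1]
    congr 1
    push_cast
    ring

theorem IsCellCycle.iterate_eq (h : IsCellCycle M u κ) (n : ℕ) (i : ZMod M) {p : ℝ × ℝ}
    (hp : p ∈ cycleTile M κ i) : (F (Real.pi / 3))^[n] p =
      rotateTo (n * (-(Real.pi / 3))) (cycleCenter M κ i)
        (cycleCenter M κ (i + ((n * u : ℕ) : ZMod M))) p := by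
  induction n with
  | zero => simp [rotateTo]
  | succ n ih =>
    have hmem : (F (Real.pi / 3))^[n] p ∈ cycleTile M κ (i + ((n * u : ℕ) : ZMod M)) := by
      rw [← h.iterate_image n i]
      exact Set.mem_image_of_mem _ hp
    have hs : cellStep (κ (i + ((n * u : ℕ) : ZMod M)).val) =
        κ (i + (((n + 1) * u : ℕ) : ZMod M)).val := by
      rw [← h.cell_add]
      congr 2
      push_cast
      ring
    rw [iterate_succ_apply', F_of_mem_cellTile hmem, hs, ih]
    simp only [cycleCenter]
    rw [rotateTo_rotateTo]
    congr 1
    push_cast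
    ring

/-- A periodic point lies in both its own tile and the image tile, and distinct tiles are disjoint.
-/
theorem IsCellCycle.dvd_of_isPeriodicPt (h : IsCellCycle M u κ) {n : ℕ} {i : ZMod M} {p : ℝ × ℝ}
    (hp : p ∈ cycleTile M κ i) (hn : IsPeriodicPt (F (Real.pi / 3)) n p) : M ∣ n * u := by
  have hmem : p ∈ cycleTile M κ (i + ((n * u : ℕ) : ZMod M)) := by
    rw [← h.iterate_image n i]
    exact ⟨p, hp, hn⟩
  rw [← ZMod.natCast_eq_zero_iff]
  by_contra hne
  exact Set.disjoint_left.mp (h.disjoint (i := i) (j := i + ((n * u : ℕ) : ZMod M))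
    (by simpa using hne)) hp hmem

theorem IsCellCycle.image_eq_self (h : IsCellCycle M u κ) {n : ℕ} (hn : M ∣ n * u) (i : ZMod M) :
    (F (Real.pi / 3))^[n] '' cycleTile M κ i = cycleTile M κ i := by
  rw [h.iterate_image, (ZMod.natCast_eq_zero_iff _ _).mpr hn, add_zero]

theorem IsCellCycle.isRotationOn (h : IsCellCycle M u κ) {n r : ℕ} (hn : M ∣ n * u)
    (hr : 6 / Nat.gcd 6 n = r) (i : ZMod M) :
    IsRotationOn ((F (Real.pi / 3))^[n]) (cycleTile M κ i) (cycleCenter M κ i) r := by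
  refine ⟨n * (-(Real.pi / 3)), by rw [addOrderOf_natCast_mul_neg_pi_div_three, hr],
    fun p hp => ?_⟩
  rw [h.iterate_eq n i hp, (ZMod.natCast_eq_zero_iff _ _).mpr hn, add_zero]
  rfl

/-- If being a period is the same as being a multiple of `N`, the minimal period is `N`. -/
theorem minimalPeriod_eq_of_isPeriodicPt_iff {α : Type*} {f : α → α} {x : α} {N : ℕ}
    (h : ∀ n, IsPeriodicPt f n x ↔ N ∣ n) : minimalPeriod f x = N :=
  Nat.dvd_antisymm (((h N).mpr dvd_rfl).minimalPeriod_dvd)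
    ((h _).mp (isPeriodicPt_minimalPeriod f x))

theorem IsCellCycle.minimalPeriod_center (h : IsCellCycle M u κ) {N : ℕ}
    (hN : ∀ n, M ∣ n * u ↔ N ∣ n) (i : ZMod M) :
    minimalPeriod (F (Real.pi / 3)) (cycleCenter M κ i) = N := by
  refine minimalPeriod_eq_of_isPeriodicPt_iff fun n => ?_
  rw [← hN]
  refine ⟨fun hn => h.dvd_of_isPeriodicPt (h.center_mem i) hn, fun hn => ?_⟩
  rw [IsPeriodicPt, IsFixedPt, h.iterate_eq n i (h.center_mem i),
    (ZMod.natCast_eq_zero_iff _ _).mpr hn, add_zero]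
  simp [rotateTo]

/-- Once the tile has returned, the iterate is a rotation of angle `-n * π / 3` about its centre,
which fixes another point only if it is trivial, that is, if `6 ∣ n`. -/
theorem IsCellCycle.minimalPeriod_of_ne (h : IsCellCycle M u κ) {N : ℕ}
    (hN : ∀ n, (M ∣ n * u ∧ 6 ∣ n) ↔ N ∣ n) (i : ZMod M) {p : ℝ × ℝ}
    (hp : p ∈ cycleTile M κ i) (hne : p ≠ cycleCenter M κ i) :
    minimalPeriod (F (Real.pi / 3)) p = N := by
  refine minimalPeriod_eq_of_isPeriodicPt_iff fun n => ?_
  rw [← hN]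
  constructor
  · intro hn
    have hd := h.dvd_of_isPeriodicPt hp hn
    have he := h.iterate_eq n i hp
    rw [(ZMod.natCast_eq_zero_iff _ _).mpr hd, add_zero] at he
    exact ⟨hd, six_dvd_of_cos_eq_one (eq_of_rotateTo_eq_self (he.symm.trans hn) hne)⟩
  · rintro ⟨hd, k, rfl⟩
    have ha : ((6 * k : ℕ) : ℝ) * (-(Real.pi / 3)) = 0 - k * (2 * Real.pi) := by push_cast; ring
    rw [IsPeriodicPt, IsFixedPt, h.iterate_eq _ i hp, (ZMod.natCast_eq_zero_iff _ _).mpr hd,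
      add_zero, rotateTo, ha, Real.cos_sub_nat_mul_two_pi, Real.sin_sub_nat_mul_two_pi]
    simp

theorem IsCellCycle.isNecklace (h : IsCellCycle M u κ) {c N : ℕ}
    (hlevel : ∀ a : ℤ × ℤ × ℤ, IsCell a → (cellLevel a = c ↔ ∃ i < M, κ i = a))
    (hpoly : ∀ i < M, IsOpenRegularPolygon N (cellTile (κ i)) (cellCenter (κ i)))
    (htouch : ∀ i, i + 1 < M → TouchingCells (κ i) (κ (i + 1)))
    (htouch' : TouchingCells (κ (M - 1)) (κ 0))
    (hclock : ∀ i, i + 1 < M → ClockwiseCells (κ i) (κ (i + 1))) :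
    IsNecklace {p | p ∈ gridᶜ ∧ V p = (c : ℝ)} N M (cycleTile M κ) (cycleCenter M κ) where
  tiles i := ⟨_, _, _, rfl⟩
  polygon i := hpoly _ (ZMod.val_lt i)
  disjoint i j hij := h.disjoint hij
  union := by
    ext p
    simp only [Set.mem_ofPred_eq, Set.mem_iUnion, Set.mem_compl_iff]
    constructor
    · rintro ⟨hp, hV⟩
      have hm := mem_cellTile_of_notMem_grid hp
      rw [V_of_mem_cellTile hm] at hV
      obtain ⟨i, hi, he⟩ := (hlevel _ (isCell_of_mem hm)).mp (by exact_mod_cast hV)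
      refine ⟨(i : ZMod M), ?_⟩
      rw [cycleTile, ZMod.val_natCast, Nat.mod_eq_of_lt hi, he]
      exact hm
    · rintro ⟨i, hi⟩
      refine ⟨notMem_grid_of_mem_cellTile hi, ?_⟩
      rw [V_of_mem_cellTile hi, (hlevel _ (isCell_of_mem hi)).mpr ⟨_, ZMod.val_lt i, rfl⟩,
        Int.cast_natCast]
  touch i := by
    have hi := ZMod.val_lt i
    have hv : (i + 1).val = (i.val + 1) % M := by
      rw [ZMod.val_add, ZMod.val_one_eq_one_mod, Nat.add_mod_mod]
    simp only [cycleTile, hv]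
    rcases (Nat.succ_le_of_lt hi).lt_or_eq with hlt | heq
    · rw [Nat.mod_eq_of_lt hlt]
      exact htouch _ hlt
    · have e1 : (i.val + 1) % M = 0 := by rw [show i.val + 1 = M from heq, Nat.mod_self]
      have e2 : i.val = M - 1 := by omega
      rw [e1, e2]
      exact htouch'
  clockwise i j hij := by
    -- Comparisons of neighbours chain by transitivity. None is needed from the last label to the
    -- first, where the argument jumps.
    have key : ∀ d a, a + d + 1 < M →
        Complex.arg ⟨(cellCenter (κ (a + d + 1))).1, (cellCenter (κ (a + d + 1))).2⟩ <
          Complex.arg ⟨(cellCenter (κ a)).1, (cellCenter (κ a)).2⟩ := by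
      intro d a hd
      induction d with
      | zero => exact (hclock a hd).arg_lt (h.isCell _ (by omega)) (h.isCell _ hd)
      | succ d ih =>
        exact ((hclock _ hd).arg_lt (h.isCell _ (by omega)) (h.isCell _ hd)).trans
          (ih (by omega))
    obtain ⟨d, hd⟩ := Nat.exists_eq_add_of_lt hij
    have := key d i.val (by have := ZMod.val_lt j; omega)
    rw [← hd] at this
    exact this

end Cycle

/-! ### Central symmetry: doubling the upper half of a level set -/

/-- The reflection of a tile in the centre of symmetry. -/
def cellNeg (c : ℤ × ℤ × ℤ) : ℤ × ℤ × ℤ := (-c.1, -1 - c.2.1, -1 - c.2.2)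

theorem cellNeg_cellNeg (c : ℤ × ℤ × ℤ) : cellNeg (cellNeg c) = c := by
  simp [cellNeg]

theorem defect_cellNeg (c : ℤ × ℤ × ℤ) : defect (cellNeg c) = -defect c := by
  simp only [defect, cellNeg]; ring

theorem isCell_cellNeg {c : ℤ × ℤ × ℤ} (h : IsCell c) : IsCell (cellNeg c) := by
  rw [IsCell, defect_cellNeg]
  exact ⟨by linarith [h.2], by linarith [h.1]⟩

theorem cellLevel_cellNeg (c : ℤ × ℤ × ℤ) : cellLevel (cellNeg c) = cellLevel c := by
  simp only [cellLevel, cellNeg]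
  congr 1
  · rw [← abs_neg]; congr 1; ring
  · congr 2
    · rw [← abs_neg]; congr 1; ring
    · rw [← abs_neg]; congr 1; ring

theorem cellStep_of_nonneg {c : ℤ × ℤ × ℤ} (h : 0 ≤ c.2.1) :
    cellStep c = (c.2.2, -c.1, c.2.1) := if_pos h

theorem cellStep_of_neg {c : ℤ × ℤ × ℤ} (h : c.2.1 < 0) :
    cellStep c = (c.2.2 + 1, -c.1 - 1, c.2.1) := if_neg (not_le.mpr h)

theorem cellStep_cellNeg (c : ℤ × ℤ × ℤ) : cellStep (cellNeg c) = cellNeg (cellStep c) := by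
  rcases le_or_gt 0 c.2.1 with h | h
  · rw [cellStep_of_nonneg h, cellStep_of_neg (by simp only [cellNeg]; omega)]
    simp only [cellNeg, Prod.mk.injEq, and_true]
    omega
  · rw [cellStep_of_neg h, cellStep_of_nonneg (by simp only [cellNeg]; omega)]
    simp only [cellNeg, Prod.mk.injEq, and_true]
    omega

theorem cellTile_cellNeg (c : ℤ × ℤ × ℤ) :
    cellTile (cellNeg c) = Homeomorph.neg (ℝ × ℝ) ⁻¹' cellTile c := by
  ext p
  simp only [cellTile, tile, cellNeg, Set.mem_preimage, Homeomorph.coe_neg, Set.mem_ofPred_eq,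
    Prod.fst_neg, Prod.snd_neg]
  push_cast
  refine and_congr ?_ (and_congr ?_ ?_) <;>
    exact ⟨fun h => ⟨by linarith [h.2], by linarith [h.1]⟩,
      fun h => ⟨by linarith [h.2], by linarith [h.1]⟩⟩

theorem TouchingCells.cellNeg {c c' : ℤ × ℤ × ℤ} (h : TouchingCells c c') :
    TouchingCells (cellNeg c) (cellNeg c') := by
  obtain ⟨p, hp, hp'⟩ := h
  rw [TouchingCells, cellTile_cellNeg, cellTile_cellNeg, ← Homeomorph.preimage_closure,
    ← Homeomorph.preimage_closure]
  exact ⟨-p, by simpa using hp, by simpa using hp'⟩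

/-- The enumeration consisting of `K` tiles above the horizontal axis, followed by their
reflections. -/
def doubled (K : ℕ) (up : ℕ → ℤ × ℤ × ℤ) (i : ℕ) : ℤ × ℤ × ℤ :=
  if i < K then up i else cellNeg (up (i - K))

section Doubled

variable {K u : ℕ} {up : ℕ → ℤ × ℤ × ℤ}

theorem doubled_of_lt {i : ℕ} (h : i < K) : doubled K up i = up i := if_pos h

theorem doubled_add (i : ℕ) : doubled K up (K + i) = cellNeg (up i) := by
  rw [doubled, if_neg (by omega), Nat.add_sub_cancel_left]

/-- `cellStep` commutes with the reflection, so the shift need only be checked on the upper half.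
The two halves are distinguished by the sign of the second index. -/
theorem isCellCycle_doubled (hcell : ∀ i < K, IsCell (up i)) (hpos : ∀ i < K, 0 ≤ (up i).2.1)
    (hinj : ∀ i < K, ∀ j < K, up i = up j → i = j) (hu : u ≤ K)
    (hstep : ∀ i < K, doubled K up (i + u) = cellStep (up i)) :
    IsCellCycle (2 * K) u (doubled K up) where
  isCell i hi := by
    rcases lt_or_ge i K with h | h
    · rw [doubled_of_lt h]; exact hcell i h
    · obtain ⟨i, rfl⟩ := Nat.exists_eq_add_of_le h
      rw [doubled_add]; exact isCell_cellNeg (hcell i (by omega))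
  inj i hi j hj he := by
    have hneg : ∀ a < K, ∀ b < K, up a ≠ cellNeg (up b) := fun a ha b hb h => by
      have h1 := hpos a ha
      have h2 := hpos b hb
      rw [h] at h1
      simp only [cellNeg] at h1
      omega
    rcases lt_or_ge i K with h | h <;> rcases lt_or_ge j K with h' | h'
    · rw [doubled_of_lt h, doubled_of_lt h'] at he
      exact hinj i h j h' he
    · obtain ⟨j, rfl⟩ := Nat.exists_eq_add_of_le h'
      rw [doubled_of_lt h, doubled_add] at he
      exact absurd he (hneg i h j (by omega))
    · obtain ⟨i, rfl⟩ := Nat.exists_eq_add_of_le h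
      rw [doubled_of_lt h', doubled_add] at he
      exact absurd he.symm (hneg j h' i (by omega))
    · obtain ⟨i, rfl⟩ := Nat.exists_eq_add_of_le h
      obtain ⟨j, rfl⟩ := Nat.exists_eq_add_of_le h'
      rw [doubled_add, doubled_add] at he
      have he' := congrArg cellNeg he
      rw [cellNeg_cellNeg, cellNeg_cellNeg] at he'
      rw [hinj i (by omega) j (by omega) he']
  step i hi := by
    rcases lt_or_ge i K with h | h
    · rw [Nat.mod_eq_of_lt (by omega), hstep i h, doubled_of_lt h]
    · obtain ⟨i, rfl⟩ := Nat.exists_eq_add_of_le h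
      rw [doubled_add, cellStep_cellNeg, ← hstep i (by omega)]
      rcases lt_or_ge (i + u) K with h' | h'
      · rw [Nat.mod_eq_of_lt (by omega), add_assoc, doubled_add, doubled_of_lt h']
      · obtain ⟨j, hj⟩ := Nat.exists_eq_add_of_le h'
        rw [add_assoc, hj, doubled_add, cellNeg_cellNeg, show K + (K + j) = j + 2 * K by ring,
          Nat.add_mod_right, Nat.mod_eq_of_lt (by omega), doubled_of_lt (by omega)]

theorem isNecklace_doubled [NeZero K] (hcycle : IsCellCycle (2 * K) u (doubled K up)) {c N : ℕ}
    (hpos : ∀ i < K, 0 ≤ (up i).2.1)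
    (hlevel : ∀ i < K, cellLevel (up i) = c)
    (hlevel' : ∀ a : ℤ × ℤ × ℤ, IsCell a → 0 ≤ a.2.1 → cellLevel a = c → ∃ i < K, up i = a)
    (hpoly : ∀ a, IsCell a → cellLevel a = c → IsOpenRegularPolygon N (cellTile a) (cellCenter a))
    (htouch : ∀ i, i + 1 < K → TouchingCells (up i) (up (i + 1)))
    (htouch' : TouchingCells (up (K - 1)) (cellNeg (up 0)))
    (hclock : ∀ i, i + 1 < K → ClockwiseCells (up i) (up (i + 1))) :
    IsNecklace {p | p ∈ gridᶜ ∧ V p = (c : ℝ)} N (2 * K)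
      (cycleTile (2 * K) (doubled K up)) (cycleCenter (2 * K) (doubled K up)) := by
  have hK : 0 < K := NeZero.pos K
  have hlev : ∀ i < 2 * K, cellLevel (doubled K up i) = c := by
    intro i hi
    rcases lt_or_ge i K with h | h
    · rw [doubled_of_lt h, hlevel i h]
    · obtain ⟨i, rfl⟩ := Nat.exists_eq_add_of_le h
      rw [doubled_add, cellLevel_cellNeg, hlevel i (by omega)]
  refine hcycle.isNecklace (fun a ha => ⟨fun h => ?_, ?_⟩)
    (fun i hi => hpoly _ (hcycle.isCell i hi) (hlev i hi)) (fun i hi => ?_) ?_ fun i hi => ?_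
  · rcases le_or_gt 0 a.2.1 with h0 | h0
    · obtain ⟨i, hi, rfl⟩ := hlevel' a ha h0 h
      exact ⟨i, by omega, doubled_of_lt hi⟩
    · obtain ⟨i, hi, he⟩ := hlevel' (cellNeg a) (isCell_cellNeg ha)
        (by simp only [cellNeg]; omega) (by rwa [cellLevel_cellNeg])
      exact ⟨K + i, by omega, by rw [doubled_add, he, cellNeg_cellNeg]⟩
  · rintro ⟨i, hi, rfl⟩
    exact hlev i hi
  · rcases lt_trichotomy (i + 1) K with h | h | h
    · rw [doubled_of_lt h, doubled_of_lt (by omega)]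
      exact htouch i h
    · obtain rfl : i = K - 1 := by omega
      have h' := doubled_add (K := K) (up := up) 0
      rw [add_zero] at h'
      rw [doubled_of_lt (by omega), h, h']
      exact htouch'
    · obtain ⟨i, rfl⟩ := Nat.exists_eq_add_of_le (show K ≤ i by omega)
      rw [add_assoc, doubled_add, doubled_add]
      exact (htouch i (by omega)).cellNeg
  · rw [show 2 * K - 1 = K + (K - 1) by omega, doubled_add, doubled_of_lt hK]
    have := htouch'.cellNeg
    rwa [cellNeg_cellNeg] at this
  · rcases lt_trichotomy (i + 1) K with h | h | h
    · rw [doubled_of_lt h, doubled_of_lt (by omega)]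
      exact hclock i h
    · obtain rfl : i = K - 1 := by omega
      have h' := doubled_add (K := K) (up := up) 0
      rw [add_zero] at h'
      rw [doubled_of_lt (by omega), h, h']
      have := hpos 0 hK
      exact Or.inl ⟨hpos _ (by omega), by simp only [cellNeg]; omega⟩
    · obtain ⟨i, rfl⟩ := Nat.exists_eq_add_of_le (show K ≤ i by omega)
      rw [add_assoc, doubled_add, doubled_add]
      have h1 := hpos i (by omega)
      have h2 := hpos (i + 1) (by omega)
      rcases hclock i (by omega) with ⟨-, h'⟩ | ⟨-, h'⟩
      · omega
      · refine Or.inr ⟨?_, ?_⟩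
        · simp only [cellNeg]; omega
        · rw [defect_cellNeg, defect_cellNeg]
          simp only [cellNeg]
          linarith

end Doubled

/-! ### Necklaces of hexagons -/

/-- The hexagons of level `2 * h` above the horizontal axis, in clockwise order. -/
def upperHexagon (h i : ℕ) : ℤ × ℤ × ℤ :=
  (max (-(h : ℤ)) (i - 2 * h), min (i : ℤ) (min (h : ℤ) (3 * h - i)),
    max (-(h : ℤ)) (i - 2 * h) + min (i : ℤ) (min (h : ℤ) (3 * h - i)))

theorem defect_upperHexagon (h i : ℕ) : defect (upperHexagon h i) = 0 := by
  simp only [defect, upperHexagon]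
  ring

theorem upperHexagon_nonneg {h i : ℕ} (hi : i < 3 * h + 1) : 0 ≤ (upperHexagon h i).2.1 := by
  simp only [upperHexagon]
  omega

theorem cellLevel_upperHexagon {h i : ℕ} (hi : i < 3 * h + 1) :
    cellLevel (upperHexagon h i) = (2 * h : ℕ) := by
  simp only [cellLevel, upperHexagon, abs_eq_max_neg]
  omega

theorem exists_upperHexagon_eq {h : ℕ} {c : ℤ × ℤ × ℤ} (hc : IsCell c) (h0 : 0 ≤ c.2.1)
    (hl : cellLevel c = (2 * h : ℕ)) : ∃ i < 3 * h + 1, upperHexagon h i = c := by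
  obtain ⟨k, l, m⟩ := c
  simp only [IsCell, defect] at hc
  simp only [cellLevel, abs_eq_max_neg] at hl
  simp only at h0
  -- The level has the parity of the defect, so an even level forces defect 0.
  obtain rfl : m = k + l := by omega
  -- For `l ≥ 0` the absolute values reduce to three one-sided bounds, and equality in one of them
  -- names the side of the chain.
  have h1 : -(h : ℤ) ≤ k ∧ l ≤ h ∧ k + l ≤ h ∧ (k = -h ∨ l = h ∨ k + l = h) := by omega
  clear hl hc
  by_cases hk : k = -h
  · refine ⟨l.toNat, by omega, ?_⟩
    simp only [upperHexagon, Prod.mk.injEq]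
    omega
  · refine ⟨(k + 2 * h).toNat, by omega, ?_⟩
    simp only [upperHexagon, Prod.mk.injEq]
    omega

theorem upperHexagon_inj {h i j : ℕ} (hi : i < 3 * h + 1) (hj : j < 3 * h + 1)
    (he : upperHexagon h i = upperHexagon h j) : i = j := by
  simp only [upperHexagon, Prod.mk.injEq] at he
  omega

/-- Above the axis the step is `(k, l, m) ↦ (m, -k, l)`, which carries each side of the chain to the
next, `h` labels further; labels beyond the upper half refer to reflected tiles. -/
theorem doubled_upperHexagon_step {h i : ℕ} (hi : i < 3 * h + 1) :
    doubled (3 * h + 1) (upperHexagon h) (i + h) = cellStep (upperHexagon h i) := by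
  rw [cellStep_of_nonneg (upperHexagon_nonneg hi)]
  rcases lt_or_ge (i + h) (3 * h + 1) with h1 | h1
  · rw [doubled_of_lt h1]
    simp only [upperHexagon, Prod.mk.injEq]
    omega
  · obtain ⟨j, hj⟩ := Nat.exists_eq_add_of_le h1
    rw [hj, doubled_add]
    simp only [upperHexagon, cellNeg, Prod.mk.injEq]
    omega

theorem isCellCycle_hexagons (h : ℕ) :
    IsCellCycle (2 * (3 * h + 1)) h (doubled (3 * h + 1) (upperHexagon h)) :=
  isCellCycle_doubled (fun i _ => by rw [IsCell, defect_upperHexagon]; norm_num)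
    (fun _ hi => upperHexagon_nonneg hi) (fun _ hi _ hj he => upperHexagon_inj hi hj he)
    (by omega) fun _ hi => doubled_upperHexagon_step hi

/-- The possible moves from a hexagon above the horizontal axis to the next one. -/
theorem upperHexagon_succ {h i : ℕ} (hi : i + 1 < 3 * h + 1) :
    ((upperHexagon h (i + 1)).1 = (upperHexagon h i).1 ∧
      (upperHexagon h (i + 1)).2.1 = (upperHexagon h i).2.1 + 1 ∧ (upperHexagon h i).1 < 0) ∨
    ((upperHexagon h (i + 1)).1 = (upperHexagon h i).1 + 1 ∧
      (upperHexagon h (i + 1)).2.1 = (upperHexagon h i).2.1) ∨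
    ((upperHexagon h (i + 1)).1 = (upperHexagon h i).1 + 1 ∧
      (upperHexagon h (i + 1)).2.1 = (upperHexagon h i).2.1 - 1 ∧ 0 ≤ (upperHexagon h i).1) := by
  simp only [upperHexagon]
  omega

theorem isNecklace_hexagons (h : ℕ) :
    IsNecklace {p | p ∈ gridᶜ ∧ V p = ((2 * h : ℕ) : ℝ)} 6 (2 * (3 * h + 1))
      (cycleTile _ (doubled (3 * h + 1) (upperHexagon h)))
      (cycleCenter _ (doubled (3 * h + 1) (upperHexagon h))) := by
  refine isNecklace_doubled (isCellCycle_hexagons h) (fun i hi => upperHexagon_nonneg hi)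
    (fun i hi => cellLevel_upperHexagon hi) (fun a ha h0 hl => exists_upperHexagon_eq ha h0 hl)
    (fun a ha hl => isOpenRegularPolygon_hexagon ?_) (fun i hi => ?_) ?_ fun i hi => ?_
  · simp only [IsCell, defect, cellLevel, abs_eq_max_neg] at *
    omega
  · exact touchingCells_hexagon (defect_upperHexagon _ _) (defect_upperHexagon _ _)
      (by have := upperHexagon_succ hi; omega)
  · refine (touchingCells_hexagon ?_ (defect_upperHexagon _ _) (Or.inl ?_)).symm
    · rw [defect_cellNeg, defect_upperHexagon, neg_zero]
    · simp only [cellNeg, upperHexagon]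
      omega
  · have h1 := upperHexagon_nonneg (h := h) (i := i) (by omega)
    have h2 := upperHexagon_nonneg hi
    refine Or.inr ⟨iff_of_true h1 h2, ?_⟩
    rw [defect_upperHexagon, defect_upperHexagon]
    rcases upperHexagon_succ hi with ⟨e1, e2, e3⟩ | ⟨e1, e2⟩ | ⟨e1, e2, e3⟩ <;>
      rw [e1, e2] <;> linarith

/-! ### Necklaces of triangles -/

/-- The triangles of level `2 * h + 1` above the horizontal axis, in clockwise order. -/
def upperTriangle (h i : ℕ) : ℤ × ℤ × ℤ :=
  if i % 2 = 0 then
    (max (-(h : ℤ)) ((i / 2 : ℕ) - 2 * h - 1),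
      min ((i / 2 : ℕ) : ℤ) (min ((h : ℤ) + 1) (3 * h + 2 - (i / 2 : ℕ))),
      max (-(h : ℤ)) ((i / 2 : ℕ) - 2 * h - 1) +
        min ((i / 2 : ℕ) : ℤ) (min ((h : ℤ) + 1) (3 * h + 2 - (i / 2 : ℕ))) - 1)
  else
    (max (-(h : ℤ) - 1) ((i / 2 : ℕ) - 2 * h - 1),
      min ((i / 2 : ℕ) : ℤ) (min (h : ℤ) (3 * h + 1 - (i / 2 : ℕ))),
      max (-(h : ℤ) - 1) ((i / 2 : ℕ) - 2 * h - 1) +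
        min ((i / 2 : ℕ) : ℤ) (min (h : ℤ) (3 * h + 1 - (i / 2 : ℕ))) + 1)

theorem upperTriangle_even (h s : ℕ) : upperTriangle h (2 * s) =
    (max (-(h : ℤ)) (s - 2 * h - 1), min (s : ℤ) (min ((h : ℤ) + 1) (3 * h + 2 - s)),
      max (-(h : ℤ)) (s - 2 * h - 1) + min (s : ℤ) (min ((h : ℤ) + 1) (3 * h + 2 - s)) - 1) := by
  rw [upperTriangle, if_pos (by omega), show 2 * s / 2 = s by omega]

theorem upperTriangle_odd (h s : ℕ) : upperTriangle h (2 * s + 1) =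
    (max (-(h : ℤ) - 1) (s - 2 * h - 1), min (s : ℤ) (min (h : ℤ) (3 * h + 1 - s)),
      max (-(h : ℤ) - 1) (s - 2 * h - 1) + min (s : ℤ) (min (h : ℤ) (3 * h + 1 - s)) + 1) := by
  rw [upperTriangle, if_neg (by omega), show (2 * s + 1) / 2 = s by omega]

theorem defect_upperTriangle_even (h s : ℕ) : defect (upperTriangle h (2 * s)) = 1 := by
  rw [upperTriangle_even, defect]
  ring

theorem defect_upperTriangle_odd (h s : ℕ) : defect (upperTriangle h (2 * s + 1)) = -1 := by
  rw [upperTriangle_odd, defect]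
  ring

theorem isCell_upperTriangle (h i : ℕ) : IsCell (upperTriangle h i) := by
  rcases Nat.even_or_odd' i with ⟨s, rfl | rfl⟩
  · rw [IsCell, defect_upperTriangle_even]; norm_num
  · rw [IsCell, defect_upperTriangle_odd]; norm_num

theorem upperTriangle_nonneg {h i : ℕ} (hi : i < 6 * h + 5) : 0 ≤ (upperTriangle h i).2.1 := by
  rcases Nat.even_or_odd' i with ⟨s, rfl | rfl⟩
  · rw [upperTriangle_even]; simp only; omega
  · rw [upperTriangle_odd]; simp only; omega

theorem cellLevel_upperTriangle {h i : ℕ} (hi : i < 6 * h + 5) :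
    cellLevel (upperTriangle h i) = (2 * h + 1 : ℕ) := by
  rcases Nat.even_or_odd' i with ⟨s, rfl | rfl⟩
  · rw [upperTriangle_even]; simp only [cellLevel, abs_eq_max_neg]; omega
  · rw [upperTriangle_odd]; simp only [cellLevel, abs_eq_max_neg]; omega

theorem defect_of_cellLevel_odd {h : ℕ} {c : ℤ × ℤ × ℤ} (hc : IsCell c)
    (hl : cellLevel c = (2 * h + 1 : ℕ)) : defect c = 1 ∨ defect c = -1 := by
  simp only [IsCell, defect, cellLevel, abs_eq_max_neg] at *
  omega

theorem exists_upperTriangle_eq {h : ℕ} {c : ℤ × ℤ × ℤ} (hc : IsCell c) (h0 : 0 ≤ c.2.1)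
    (hl : cellLevel c = (2 * h + 1 : ℕ)) : ∃ i < 6 * h + 5, upperTriangle h i = c := by
  have hd := defect_of_cellLevel_odd hc hl
  obtain ⟨k, l, m⟩ := c
  simp only [defect] at hd
  simp only [cellLevel, abs_eq_max_neg] at hl
  simp only at h0
  clear hc
  rcases hd with hd | hd
  · obtain rfl : m = k + l - 1 := by omega
    have h1 : -(h : ℤ) ≤ k ∧ l ≤ h + 1 ∧ k + l ≤ h + 1 ∧
      (k = -h ∨ l = h + 1 ∨ k + l = h + 1) := by omega
    clear hl hd
    by_cases hk : k = -h
    · refine ⟨2 * l.toNat, by omega, ?_⟩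
      simp only [upperTriangle_even, Prod.mk.injEq]
      omega
    · refine ⟨2 * (k + 2 * h + 1).toNat, by omega, ?_⟩
      simp only [upperTriangle_even, Prod.mk.injEq]
      omega
  · obtain rfl : m = k + l + 1 := by omega
    have h1 : -(h : ℤ) - 1 ≤ k ∧ l ≤ h ∧ k + l ≤ h ∧
      (k = -h - 1 ∨ l = h ∨ k + l = h) := by omega
    clear hl hd
    by_cases hk : k = -h - 1
    · refine ⟨2 * l.toNat + 1, by omega, ?_⟩
      simp only [upperTriangle_odd, Prod.mk.injEq]
      omega
    · refine ⟨2 * (k + 2 * h + 1).toNat + 1, by omega, ?_⟩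
      simp only [upperTriangle_odd, Prod.mk.injEq]
      omega

theorem upperTriangle_inj {h i j : ℕ} (hi : i < 6 * h + 5) (hj : j < 6 * h + 5)
    (he : upperTriangle h i = upperTriangle h j) : i = j := by
  rcases Nat.even_or_odd' i with ⟨s, rfl | rfl⟩ <;> rcases Nat.even_or_odd' j with ⟨t, rfl | rfl⟩
  · simp only [upperTriangle_even, Prod.mk.injEq] at he; omega
  · simp only [upperTriangle_even, upperTriangle_odd, Prod.mk.injEq] at he; omega
  · simp only [upperTriangle_even, upperTriangle_odd, Prod.mk.injEq] at he; omega
  · simp only [upperTriangle_odd, Prod.mk.injEq] at he; omega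

/-- The shift is odd and so is the length `6 * h + 5` of a half. Within the upper half the two
orientations are exchanged; past its end the label parity is kept and the reflection exchanges them.
-/
theorem doubled_upperTriangle_step {h i : ℕ} (hi : i < 6 * h + 5) :
    doubled (6 * h + 5) (upperTriangle h) (i + (2 * h + 1)) = cellStep (upperTriangle h i) := by
  rw [cellStep_of_nonneg (upperTriangle_nonneg hi)]
  rcases Nat.even_or_odd' i with ⟨s, rfl | rfl⟩
  · rcases lt_or_ge (2 * s + (2 * h + 1)) (6 * h + 5) with h1 | h1
    · rw [doubled_of_lt h1, show 2 * s + (2 * h + 1) = 2 * (s + h) + 1 by ring]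
      simp only [upperTriangle_even, upperTriangle_odd, Prod.mk.injEq]
      omega
    · obtain ⟨j, hj⟩ : ∃ j, s = 2 * h + 2 + j := ⟨s - (2 * h + 2), by omega⟩
      rw [show 2 * s + (2 * h + 1) = 6 * h + 5 + 2 * j by omega, doubled_add]
      simp only [upperTriangle_even, cellNeg, Prod.mk.injEq]
      omega
  · rcases lt_or_ge (2 * s + 1 + (2 * h + 1)) (6 * h + 5) with h1 | h1
    · rw [doubled_of_lt h1, show 2 * s + 1 + (2 * h + 1) = 2 * (s + h + 1) by ring]
      simp only [upperTriangle_even, upperTriangle_odd, Prod.mk.injEq]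
      omega
    · obtain ⟨j, hj⟩ : ∃ j, s = 2 * h + 2 + j := ⟨s - (2 * h + 2), by omega⟩
      rw [show 2 * s + 1 + (2 * h + 1) = 6 * h + 5 + (2 * j + 1) by omega, doubled_add]
      simp only [upperTriangle_odd, cellNeg, Prod.mk.injEq]
      omega

theorem isCellCycle_triangles (h : ℕ) :
    IsCellCycle (2 * (6 * h + 5)) (2 * h + 1) (doubled (6 * h + 5) (upperTriangle h)) :=
  isCellCycle_doubled (fun i _ => isCell_upperTriangle h i)
    (fun _ hi => upperTriangle_nonneg hi) (fun _ hi _ hj he => upperTriangle_inj hi hj he)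
    (by omega) fun _ hi => doubled_upperTriangle_step hi

/-- The possible moves from an upward triangle above the horizontal axis to the next triangle. -/
theorem upperTriangle_succ_even {h s : ℕ} (hs : 2 * s + 1 < 6 * h + 5) :
    ((upperTriangle h (2 * s + 1)).1 = (upperTriangle h (2 * s)).1 - 1 ∧
      (upperTriangle h (2 * s + 1)).2.1 = (upperTriangle h (2 * s)).2.1 ∧
      (upperTriangle h (2 * s)).2.1 ≤ - (upperTriangle h (2 * s)).1) ∨
    ((upperTriangle h (2 * s + 1)).1 = (upperTriangle h (2 * s)).1 ∧
      (upperTriangle h (2 * s + 1)).2.1 = (upperTriangle h (2 * s)).2.1 - 1 ∧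
      0 < 2 * (upperTriangle h (2 * s)).2.1 + (upperTriangle h (2 * s)).1) := by
  simp only [upperTriangle_even, upperTriangle_odd]
  omega

/-- The possible moves from a downward triangle above the horizontal axis to the next triangle. -/
theorem upperTriangle_succ_odd {h s : ℕ} (hs : 2 * s + 2 < 6 * h + 5) :
    ((upperTriangle h (2 * (s + 1))).1 = (upperTriangle h (2 * s + 1)).1 + 1 ∧
      (upperTriangle h (2 * (s + 1))).2.1 = (upperTriangle h (2 * s + 1)).2.1 + 1 ∧
      (upperTriangle h (2 * s + 1)).1 ≤ (upperTriangle h (2 * s + 1)).2.1) ∨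
    ((upperTriangle h (2 * (s + 1))).1 = (upperTriangle h (2 * s + 1)).1 + 1 ∧
      (upperTriangle h (2 * (s + 1))).2.1 = (upperTriangle h (2 * s + 1)).2.1 ∧
      0 ≤ (upperTriangle h (2 * s + 1)).1) := by
  simp only [upperTriangle_even, upperTriangle_odd]
  omega

theorem isNecklace_triangles (h : ℕ) :
    IsNecklace {p | p ∈ gridᶜ ∧ V p = ((2 * h + 1 : ℕ) : ℝ)} 3 (2 * (6 * h + 5))
      (cycleTile _ (doubled (6 * h + 5) (upperTriangle h)))
      (cycleCenter _ (doubled (6 * h + 5) (upperTriangle h))) := by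
  refine isNecklace_doubled (isCellCycle_triangles h) (fun i hi => upperTriangle_nonneg hi)
    (fun i hi => cellLevel_upperTriangle hi) (fun a ha h0 hl => exists_upperTriangle_eq ha h0 hl)
    (fun a ha hl => isOpenRegularPolygon_triangle (defect_of_cellLevel_odd ha hl))
    (fun i hi => ?_) ?_ fun i hi => ?_
  · rcases Nat.even_or_odd' i with ⟨s, rfl | rfl⟩
    · exact touchingCells_triangle (defect_upperTriangle_even _ _) (defect_upperTriangle_odd _ _)
        (by have := upperTriangle_succ_even hi; omega)
    · exact (touchingCells_triangle (defect_upperTriangle_even h (s + 1))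
        (defect_upperTriangle_odd _ _) (by have := upperTriangle_succ_odd hi; omega)).symm
  · refine touchingCells_triangle ?_ ?_ (Or.inr (Or.inr ?_))
    · rw [show 6 * h + 5 - 1 = 2 * (3 * h + 2) by omega, defect_upperTriangle_even]
    · rw [defect_cellNeg, defect_upperTriangle_even h 0]
    · rw [show 6 * h + 5 - 1 = 2 * (3 * h + 2) by omega, ← mul_zero 2]
      simp only [cellNeg, upperTriangle_even]
      omega
  · have h1 := upperTriangle_nonneg (h := h) (i := i) (by omega)
    have h2 := upperTriangle_nonneg hi
    refine Or.inr ⟨iff_of_true h1 h2, ?_⟩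
    rcases Nat.even_or_odd' i with ⟨s, rfl | rfl⟩
    · rw [defect_upperTriangle_even, defect_upperTriangle_odd]
      rcases upperTriangle_succ_even hi with ⟨e1, e2, e3⟩ | ⟨e1, e2, e3⟩ <;>
        rw [e1, e2] <;> linarith
    · rw [show 2 * s + 1 + 1 = 2 * (s + 1) by ring, defect_upperTriangle_even,
        defect_upperTriangle_odd]
      rcases upperTriangle_succ_odd hi with ⟨e1, e2, e3⟩ | ⟨e1, e2, e3⟩ <;>
        rw [e1, e2] <;> linarith

/-! ### Periods off the grid -/

/-- The hexagons of level `2 * h`. -/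
def hexagonTile (h : ℕ) : ZMod (2 * (3 * h + 1)) → Set (ℝ × ℝ) :=
  cycleTile _ (doubled (3 * h + 1) (upperHexagon h))

/-- The centres of the hexagons of level `2 * h`. -/
noncomputable def hexagonCenter (h : ℕ) : ZMod (2 * (3 * h + 1)) → ℝ × ℝ :=
  cycleCenter _ (doubled (3 * h + 1) (upperHexagon h))

/-- The triangles of level `2 * h + 1`. -/
def triangleTile (h : ℕ) : ZMod (2 * (6 * h + 5)) → Set (ℝ × ℝ) :=
  cycleTile _ (doubled (6 * h + 5) (upperTriangle h))

/-- The centres of the triangles of level `2 * h + 1`. -/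
noncomputable def triangleCenter (h : ℕ) : ZMod (2 * (6 * h + 5)) → ℝ × ℝ :=
  cycleCenter _ (doubled (6 * h + 5) (upperTriangle h))

theorem dvd_mul_iff_of_even (j n : ℕ) :
    2 * (3 * (2 * j) + 1) ∣ n * (2 * j) ↔ 6 * j + 1 ∣ n := by
  have hco : Nat.Coprime (6 * j + 1) j :=
    Nat.isCoprime_iff_coprime.mp ⟨1, -6, by push_cast; ring⟩
  rw [show 2 * (3 * (2 * j) + 1) = 2 * (6 * j + 1) by ring, show n * (2 * j) = 2 * (n * j) by ring,
    Nat.mul_dvd_mul_iff_left (by norm_num), hco.dvd_mul_right]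

theorem dvd_mul_iff_of_odd (j n : ℕ) :
    2 * (3 * (2 * j + 1) + 1) ∣ n * (2 * j + 1) ↔ 12 * j + 8 ∣ n := by
  have hco : Nat.Coprime (12 * j + 8) (2 * j + 1) :=
    Nat.isCoprime_iff_coprime.mp ⟨-j, 6 * j + 1, by push_cast; ring⟩
  rw [show 2 * (3 * (2 * j + 1) + 1) = 12 * j + 8 by ring, hco.dvd_mul_right]

theorem dvd_mul_iff_triangle (h n : ℕ) :
    2 * (6 * h + 5) ∣ n * (2 * h + 1) ↔ 12 * h + 10 ∣ n := by
  -- The Bézout coefficients come from `(2 * h + 1) ^ 2 = 4 * (h * (h + 1)) + 1` and `12 * h + 10 =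
  -- 6 * (2 * h + 1) + 4`.
  have hco : Nat.Coprime (12 * h + 10) (2 * h + 1) :=
    Nat.isCoprime_iff_coprime.mp
      ⟨-(h * (h + 1)), 2 * h + 1 + 6 * (h * (h + 1)), by push_cast; ring⟩
  rw [show 2 * (6 * h + 5) = 12 * h + 10 by ring, hco.dvd_mul_right]

theorem dvd_and_six_dvd_iff_of_coprime {a n : ℕ} (h : Nat.Coprime a 6) :
    (a ∣ n ∧ 6 ∣ n) ↔ a * 6 ∣ n :=
  ⟨fun hn => h.mul_dvd_of_dvd_of_dvd hn.1 hn.2,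
    fun hn => ⟨(Dvd.intro _ rfl).trans hn, (Dvd.intro_left _ rfl).trans hn⟩⟩

theorem dvd_and_six_dvd_iff_of_even {a n : ℕ} (h : Nat.Coprime a 3) (ha : 2 ∣ a) :
    (a ∣ n ∧ 6 ∣ n) ↔ a * 3 ∣ n := by
  constructor
  · intro hn
    exact h.mul_dvd_of_dvd_of_dvd hn.1 ((by norm_num : 3 ∣ 6).trans hn.2)
  · intro hn
    refine ⟨(Dvd.intro _ rfl).trans hn, (?_ : 6 ∣ a * 3).trans hn⟩
    exact mul_dvd_mul ha (dvd_refl 3)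

theorem minimalPeriod_hexagonCenter_even (j : ℕ) (i) :
    minimalPeriod (F (Real.pi / 3)) (hexagonCenter (2 * j) i) = 6 * j + 1 :=
  (isCellCycle_hexagons (2 * j)).minimalPeriod_center (dvd_mul_iff_of_even j) i

theorem minimalPeriod_hexagonCenter_odd (j : ℕ) (i) :
    minimalPeriod (F (Real.pi / 3)) (hexagonCenter (2 * j + 1) i) = 12 * j + 8 :=
  (isCellCycle_hexagons (2 * j + 1)).minimalPeriod_center (dvd_mul_iff_of_odd j) i

theorem minimalPeriod_triangleCenter (h : ℕ) (i) :
    minimalPeriod (F (Real.pi / 3)) (triangleCenter h i) = 12 * h + 10 :=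
  (isCellCycle_triangles h).minimalPeriod_center (dvd_mul_iff_triangle h) i

/-- This is the least common multiple of 6 and the period of the centre, `6 * j + 1` or `12 * j +
8`; the result happens to be uniform in `h`. -/
theorem minimalPeriod_hexagonTile (h : ℕ) {i} {p : ℝ × ℝ} (hp : p ∈ hexagonTile h i)
    (hne : p ≠ hexagonCenter h i) : minimalPeriod (F (Real.pi / 3)) p = 18 * h + 6 := by
  refine (isCellCycle_hexagons h).minimalPeriod_of_ne (fun n => ?_) i hp hne
  rcases Nat.even_or_odd' h with ⟨j, rfl | rfl⟩
  · have hco : Nat.Coprime (6 * j + 1) 6 :=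
      Nat.isCoprime_iff_coprime.mp ⟨1, -j, by push_cast; ring⟩
    rw [dvd_mul_iff_of_even, dvd_and_six_dvd_iff_of_coprime hco,
      show (6 * j + 1) * 6 = 18 * (2 * j) + 6 by ring]
  · have hco : Nat.Coprime (12 * j + 8) 3 :=
      Nat.isCoprime_iff_coprime.mp ⟨-1, 4 * j + 3, by push_cast; ring⟩
    rw [dvd_mul_iff_of_odd, dvd_and_six_dvd_iff_of_even hco ⟨6 * j + 4, by ring⟩,
      show (12 * j + 8) * 3 = 18 * (2 * j + 1) + 6 by ring]

theorem minimalPeriod_triangleTile (h : ℕ) {i} {p : ℝ × ℝ} (hp : p ∈ triangleTile h i)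
    (hne : p ≠ triangleCenter h i) : minimalPeriod (F (Real.pi / 3)) p = 36 * h + 30 := by
  refine (isCellCycle_triangles h).minimalPeriod_of_ne (fun n => ?_) i hp hne
  have hco : Nat.Coprime (12 * h + 10) 3 :=
    Nat.isCoprime_iff_coprime.mp ⟨1, -4 * h - 3, by push_cast; ring⟩
  rw [dvd_mul_iff_triangle, dvd_and_six_dvd_iff_of_even hco ⟨6 * h + 5, by ring⟩,
    show (12 * h + 10) * 3 = 36 * h + 30 by ring]

theorem exists_mem_cellTile_ne_cellCenter {c : ℤ × ℤ × ℤ} (h : IsCell c) :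
    ∃ p ∈ cellTile c, p ≠ cellCenter c := by
  obtain ⟨k, l, m⟩ := c
  refine ⟨affineCoord (k + 1 / 2 - defect (k, l, m) / 3 + 1 / 12,
    l + 1 / 2 - defect (k, l, m) / 3), (affineCoord_mem_tile_iff k l m _ _).mpr ?_, fun he => ?_⟩
  · rcases cast_defect_cases h with ⟨h1, h2⟩ | ⟨h1, h2⟩ | ⟨h1, h2⟩ <;> rw [h2] <;>
      simp only at h1 ⊢ <;> refine ⟨⟨?_, ?_⟩, ⟨?_, ?_⟩, ⟨?_, ?_⟩⟩ <;> linarith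
  · have := (Prod.mk.inj (affineCoord.injective he)).1
    simp only at this
    linarith

theorem exists_hexagonTile_ne (h : ℕ) (i) : ∃ p ∈ hexagonTile h i, p ≠ hexagonCenter h i :=
  exists_mem_cellTile_ne_cellCenter ((isCellCycle_hexagons h).isCell _ (ZMod.val_lt i))

theorem exists_triangleTile_ne (h : ℕ) (i) : ∃ p ∈ triangleTile h i, p ≠ triangleCenter h i :=
  exists_mem_cellTile_ne_cellCenter ((isCellCycle_triangles h).isCell _ (ZMod.val_lt i))

theorem mem_hexagonTile_iff (h : ℕ) (p : ℝ × ℝ) :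
    (p ∉ grid ∧ V p = ((2 * h : ℕ) : ℝ)) ↔ ∃ i, p ∈ hexagonTile h i := by
  rw [← Set.mem_iUnion]
  exact Set.ext_iff.mp (isNecklace_hexagons h).union p

theorem mem_triangleTile_iff (h : ℕ) (p : ℝ × ℝ) :
    (p ∉ grid ∧ V p = ((2 * h + 1 : ℕ) : ℝ)) ↔ ∃ i, p ∈ triangleTile h i := by
  rw [← Set.mem_iUnion]
  exact Set.ext_iff.mp (isNecklace_triangles h).union p

theorem exists_tile_of_notMem_grid {p : ℝ × ℝ} (hp : p ∉ grid) :
    (∃ h i, p ∈ hexagonTile h i) ∨ ∃ h i, p ∈ triangleTile h i := by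
  have hV := V_of_mem_cellTile (mem_cellTile_of_notMem_grid hp)
  have h0 : 0 ≤ cellLevel (B p, C p, D p) := (abs_nonneg _).trans (le_max_left _ _)
  obtain ⟨c, hc⟩ := Int.eq_ofNat_of_zero_le h0
  rw [hc, Int.cast_natCast] at hV
  rcases Nat.even_or_odd' c with ⟨h, rfl | rfl⟩
  · exact Or.inl ⟨h, (mem_hexagonTile_iff h p).mp ⟨hp, hV⟩⟩
  · exact Or.inr ⟨h, (mem_triangleTile_iff h p).mp ⟨hp, hV⟩⟩

/-- Each level set off the grid is a union of tiles that the shift permutes, hence invariant; levels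
0 and 1 both occur. -/
theorem isFirstIntegralOn_V : IsFirstIntegralOn (F (Real.pi / 3)) V gridᶜ := by
  have key : ∀ p ∉ grid, F (Real.pi / 3) p ∉ grid ∧ V (F (Real.pi / 3) p) = V p := by
    intro p hp
    rcases exists_tile_of_notMem_grid hp with ⟨h, i, hi⟩ | ⟨h, i, hi⟩
    · have hF : F (Real.pi / 3) p ∈ hexagonTile h (i + (h : ZMod _)) := by
        have := ((isCellCycle_hexagons h).actsAsShift i).1
        exact this.subset (Set.mem_image_of_mem _ hi)
      have h1 := (mem_hexagonTile_iff h _).mpr ⟨_, hF⟩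
      exact ⟨h1.1, h1.2.trans ((mem_hexagonTile_iff h p).mpr ⟨i, hi⟩).2.symm⟩
    · have hF : F (Real.pi / 3) p ∈ triangleTile h (i + ((2 * h + 1 : ℕ) : ZMod _)) := by
        have := ((isCellCycle_triangles h).actsAsShift i).1
        exact this.subset (Set.mem_image_of_mem _ hi)
      have h1 := (mem_triangleTile_iff h _).mpr ⟨_, hF⟩
      exact ⟨h1.1, h1.2.trans ((mem_triangleTile_iff h p).mpr ⟨i, hi⟩).2.symm⟩
  refine ⟨fun p hp => (key p hp).1, fun p hp => (key p hp).2, ?_⟩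
  obtain ⟨p, hp, -⟩ := exists_hexagonTile_ne 0 0
  obtain ⟨q, hq, -⟩ := exists_triangleTile_ne 0 0
  have h1 := (mem_hexagonTile_iff 0 p).mpr ⟨_, hp⟩
  have h2 := (mem_triangleTile_iff 0 q).mpr ⟨_, hq⟩
  exact ⟨p, h1.1, q, h2.1, by rw [h1.2, h2.2]; norm_num⟩

/-- The periods of the points off the grid. -/
theorem minimalPeriod_of_notMem_grid {p : ℝ × ℝ} (hp : p ∉ grid) :
    ∃ n : ℕ, minimalPeriod (F (Real.pi / 3)) p ∈
      ({6 * n + 1, 12 * n + 8, 12 * n + 10, 36 * n + 6, 36 * n + 24, 36 * n + 30} : Set ℕ) := by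
  simp only [Set.mem_insert_iff, Set.mem_singleton_iff]
  rcases exists_tile_of_notMem_grid hp with ⟨h, i, hi⟩ | ⟨h, i, hi⟩
  · rcases Nat.even_or_odd' h with ⟨j, rfl | rfl⟩
    · refine ⟨j, ?_⟩
      by_cases hc : p = hexagonCenter (2 * j) i
      · rw [hc, minimalPeriod_hexagonCenter_even]; omega
      · rw [minimalPeriod_hexagonTile _ hi hc]; omega
    · refine ⟨j, ?_⟩
      by_cases hc : p = hexagonCenter (2 * j + 1) i
      · rw [hc, minimalPeriod_hexagonCenter_odd]; omega
      · rw [minimalPeriod_hexagonTile _ hi hc]; omega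
  · refine ⟨h, ?_⟩
    by_cases hc : p = triangleCenter h i
    · rw [hc, minimalPeriod_triangleCenter]; omega
    · rw [minimalPeriod_triangleTile _ hi hc]; omega

/-! ### Pointwise periodicity and the set of periods -/

/-- The set of periods of `F (π / 3)`. -/
def allPeriods : Set ℕ :=
  {q | ∃ n : ℕ, q ∈ ({6 * n + 1, 12 * n + 8, 12 * n + 10, 18 * n + 9, 18 * n + 15,
    36 * n + 6, 36 * n + 24, 36 * n + 30, 108 * n + 72} : Set ℕ)}

theorem minimalPeriod_mem_allPeriods (p : ℝ × ℝ) :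
    minimalPeriod (F (Real.pi / 3)) p ∈ allPeriods := by
  by_cases hp : p ∈ grid
  · obtain ⟨n, hn⟩ := minimalPeriod_mem_gridPeriods_of_grid hp
    refine ⟨n, ?_⟩
    simp only [Set.mem_insert_iff, Set.mem_singleton_iff] at hn ⊢
    tauto
  · obtain ⟨n, hn⟩ := minimalPeriod_of_notMem_grid hp
    refine ⟨n, ?_⟩
    simp only [Set.mem_insert_iff, Set.mem_singleton_iff] at hn ⊢
    tauto

theorem mem_periodicPts (p : ℝ × ℝ) : p ∈ periodicPts (F (Real.pi / 3)) := by
  refine minimalPeriod_pos_iff_mem_periodicPts.mp ?_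
  obtain ⟨n, hn⟩ := minimalPeriod_mem_allPeriods p
  simp only [Set.mem_insert_iff, Set.mem_singleton_iff] at hn
  omega

theorem Per_eq_allPeriods : Per (F (Real.pi / 3)) = allPeriods := by
  ext q
  constructor
  · rintro ⟨p, -, rfl⟩
    exact minimalPeriod_mem_allPeriods p
  · rintro ⟨n, hn⟩
    suffices h : ∃ p, minimalPeriod (F (Real.pi / 3)) p = q by
      obtain ⟨p, hp⟩ := h
      exact ⟨p, mem_periodicPts p, hp⟩
    simp only [Set.mem_insert_iff, Set.mem_singleton_iff] at hn
    rcases hn with rfl | rfl | rfl | rfl | rfl | rfl | rfl | rfl | rfl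
    · exact ⟨_, minimalPeriod_hexagonCenter_even n 0⟩
    · exact ⟨_, minimalPeriod_hexagonCenter_odd n 0⟩
    · exact ⟨_, minimalPeriod_triangleCenter n 0⟩
    · exact ⟨_, (minimalPeriod_affineCoord _).trans (minimalPeriod_even_nonpos n)⟩
    · exact ⟨_, (minimalPeriod_affineCoord _).trans (minimalPeriod_even_pos n)⟩
    · obtain ⟨p, hp, hne⟩ := exists_hexagonTile_ne (2 * n) 0
      exact ⟨p, by rw [minimalPeriod_hexagonTile _ hp hne]; ring⟩
    · obtain ⟨p, hp, hne⟩ := exists_hexagonTile_ne (2 * n + 1) 0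
      exact ⟨p, by rw [minimalPeriod_hexagonTile _ hp hne]; ring⟩
    · obtain ⟨p, hp, hne⟩ := exists_triangleTile_ne n 0
      exact ⟨p, minimalPeriod_triangleTile _ hp hne⟩
    · exact ⟨_, (minimalPeriod_affineCoord _).trans
        (minimalPeriod_long_edge n (g := 1 / 4) (by norm_num) (by norm_num)).1⟩

end PiecewiseRotation

/-! ### Assembly of the theorem -/

theorem theoremC :
    -- (i) the critical set
    PiecewiseRotation.criticalSet (Real.pi / 3) = PiecewiseRotation.grid ∧
    -- (ii) the first integral
    PiecewiseRotation.IsFirstIntegralOn (PiecewiseRotation.F (Real.pi / 3))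
      PiecewiseRotation.V PiecewiseRotation.gridᶜ ∧
    -- (ii)(a) even levels
    (∀ c : ℕ, Even c →
      ∃ (T : ZMod (3 * c + 2) → Set (ℝ × ℝ)) (X : ZMod (3 * c + 2) → ℝ × ℝ),
        PiecewiseRotation.IsNecklace
          {p | p ∈ PiecewiseRotation.gridᶜ ∧ PiecewiseRotation.V p = (c : ℝ)}
          6 (3 * c + 2) T X ∧
        PiecewiseRotation.ActsAsShift (PiecewiseRotation.F (Real.pi / 3)) T X (c / 2) ∧
        (c % 4 = 0 → ∀ i,
          (PiecewiseRotation.F (Real.pi / 3))^[3 * (c / 2) + 1] '' T i = T i ∧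
          PiecewiseRotation.IsRotationOn
            ((PiecewiseRotation.F (Real.pi / 3))^[3 * (c / 2) + 1]) (T i) (X i) 6) ∧
        (c % 4 = 2 → ∀ i,
          (PiecewiseRotation.F (Real.pi / 3))^[3 * c + 2] '' T i = T i ∧
          PiecewiseRotation.IsRotationOn
            ((PiecewiseRotation.F (Real.pi / 3))^[3 * c + 2]) (T i) (X i) 3) ∧
        (∀ i, ∀ p ∈ T i, p ≠ X i →
          Function.minimalPeriod (PiecewiseRotation.F (Real.pi / 3)) p = 9 * c + 6)) ∧
    -- (ii)(b) odd levels
    (∀ c : ℕ, Odd c →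
      ∃ (T : ZMod (6 * c + 4) → Set (ℝ × ℝ)) (X : ZMod (6 * c + 4) → ℝ × ℝ),
        PiecewiseRotation.IsNecklace
          {p | p ∈ PiecewiseRotation.gridᶜ ∧ PiecewiseRotation.V p = (c : ℝ)}
          3 (6 * c + 4) T X ∧
        PiecewiseRotation.ActsAsShift (PiecewiseRotation.F (Real.pi / 3)) T X c ∧
        (∀ i,
          (PiecewiseRotation.F (Real.pi / 3))^[6 * c + 4] '' T i = T i ∧
          PiecewiseRotation.IsRotationOn
            ((PiecewiseRotation.F (Real.pi / 3))^[6 * c + 4]) (T i) (X i) 3) ∧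
        (∀ i, ∀ p ∈ T i, p ≠ X i →
          Function.minimalPeriod (PiecewiseRotation.F (Real.pi / 3)) p = 18 * c + 12)) ∧
    -- (iii) the critical points
    (∀ p ∈ PiecewiseRotation.criticalSet (Real.pi / 3), ∃ n : ℕ,
      Function.minimalPeriod (PiecewiseRotation.F (Real.pi / 3)) p
        ∈ ({36 * n + 6, 18 * n + 9, 18 * n + 15, 108 * n + 72} : Set ℕ)) ∧
    -- (iv) pointwise periodicity and the set of periods
    PiecewiseRotation.PointwisePeriodic (PiecewiseRotation.F (Real.pi / 3)) ∧
    PiecewiseRotation.Per (PiecewiseRotation.F (Real.pi / 3)) =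
      {q | ∃ n : ℕ, q ∈ ({6 * n + 1, 12 * n + 8, 12 * n + 10, 18 * n + 9, 18 * n + 15,
        36 * n + 6, 36 * n + 24, 36 * n + 30, 108 * n + 72} : Set ℕ)} := by
  refine ⟨PiecewiseRotation.criticalSet_eq_grid, PiecewiseRotation.isFirstIntegralOn_V,
    fun c hc => ?_, fun c hc => ?_, fun p hp => ?_,
    ⟨PiecewiseRotation.F_bijective, PiecewiseRotation.mem_periodicPts⟩,
    PiecewiseRotation.Per_eq_allPeriods⟩
  · obtain ⟨h, rfl⟩ := even_iff_two_dvd.mp hc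
    have cycle := PiecewiseRotation.isCellCycle_hexagons h
    rw [show 3 * (2 * h) + 2 = 2 * (3 * h + 1) by ring, Nat.mul_div_cancel_left h two_pos,
      show 9 * (2 * h) + 6 = 18 * h + 6 by ring]
    refine ⟨PiecewiseRotation.hexagonTile h, PiecewiseRotation.hexagonCenter h,
      PiecewiseRotation.isNecklace_hexagons h, cycle.actsAsShift, fun h4 i => ?_, fun h4 i => ?_,
      fun i p hp hne => PiecewiseRotation.minimalPeriod_hexagonTile h hp hne⟩
    -- When `4` divides the level, `h` is even and supplies the factor 2, so half the number of
    -- tiles already suffices as exponent.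
    · have hdvd : 2 * (3 * h + 1) ∣ (3 * h + 1) * h := by
        rw [mul_comm]
        exact mul_dvd_mul_left _ (by omega)
      refine ⟨cycle.image_eq_self hdvd i, cycle.isRotationOn hdvd ?_ i⟩
      rw [Nat.gcd_rec, show (3 * h + 1) % 6 = 1 by omega]
      norm_num
    · have hdvd : 2 * (3 * h + 1) ∣ 2 * (3 * h + 1) * h := Dvd.intro _ rfl
      refine ⟨cycle.image_eq_self hdvd i, cycle.isRotationOn hdvd ?_ i⟩
      rw [Nat.gcd_rec, show 2 * (3 * h + 1) % 6 = 2 by omega]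
      norm_num
  · obtain ⟨h, rfl⟩ := hc
    have cycle := PiecewiseRotation.isCellCycle_triangles h
    rw [show 6 * (2 * h + 1) + 4 = 2 * (6 * h + 5) by ring,
      show 18 * (2 * h + 1) + 12 = 36 * h + 30 by ring]
    have hdvd : 2 * (6 * h + 5) ∣ 2 * (6 * h + 5) * (2 * h + 1) := Dvd.intro _ rfl
    refine ⟨PiecewiseRotation.triangleTile h, PiecewiseRotation.triangleCenter h,
      PiecewiseRotation.isNecklace_triangles h, cycle.actsAsShift,
      fun i => ⟨cycle.image_eq_self hdvd i, cycle.isRotationOn hdvd ?_ i⟩,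
      fun i p hp hne => PiecewiseRotation.minimalPeriod_triangleTile h hp hne⟩
    rw [Nat.gcd_rec, show 2 * (6 * h + 5) % 6 = 4 by omega]
    norm_num
  · rw [PiecewiseRotation.criticalSet_eq_grid] at hp
    exact PiecewiseRotation.minimalPeriod_mem_gridPeriods_of_grid hp
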